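/- Let $n\ge 4$ be even, and let $p_0,\dots,p_{n-1}$ be points in strictly convex position in the Euclidean plane, that is, the vertices of a strictly convex polygon, listed in their cyclic order around it; indices are taken mod $n$. A tour is an undirected closed polygon that visits each of the points exactly once, identified with its set of edges, and its length is the sum of the Euclidean lengths of its edges. A 2-exchange takes two edges of a tour that are directed as $(p_i,p_k)$ and $(p_j,p_l)$ in a traversal of the tour, and replaces them by the edges $(p_i,p_j)$ and $(p_l,p_k)$; a tour is locally optimal if no 2-exchange increases its length. Then: 1. Every locally optimal tour contains, for some $i$, the two consecutive diagonals $(p_i,p_{i+n/2})$ and $(p_{i+1},p_{i+1+n/2})$, and each of its other edges is a near-diagonal $(p_j,p_{j+n/2-1})$ for some $j$. 2. There are at most $n/2$ locally optimal tours. 3. The best locally optimal tour, which is a longest of all tours, can be found in linear time: there are a constant $C$ and a real RAM program (exact real arithmetic with square roots and comparisons at unit cost, and integers of size $O(n)$) that, for every such $n$ and every such sequence of points given by their coordinates, outputs a locally optimal tour of maximum length among all tours after at most $Cn$ steps. -/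

import Mathlib

noncomputable section

namespace MaxTSP

/-- The Euclidean plane. -/
abbrev Plane : Type := EuclideanSpace ℝ (Fin 2)

/-- Twice the signed area of the triangle `a b c`: positive if `c` is strictly to the left of the
directed line from `a` to `b`, negative if it is strictly to the right, and zero if the three
points are collinear. -/
def orient (a b c : Plane) : ℝ :=
  (b 0 - a 0) * (c 1 - a 1) - (b 1 - a 1) * (c 0 - a 0)

/-- `p 0, p 1, …, p (n - 1)` are the vertices of a strictly convex polygon, listed in their cyclic
order around it (counterclockwise or clockwise; indices are mod `n`): for every side
`p i, p (i + 1)`, all the other points lie strictly on the inner side of the line through it. -/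
def IsConvexPolygon {n : ℕ} (p : ZMod n → Plane) : Prop :=
  (∀ i j : ZMod n, j ≠ i → j ≠ i + 1 → 0 < orient (p i) (p (i + 1)) (p j)) ∨
  (∀ i j : ZMod n, j ≠ i → j ≠ i + 1 → orient (p i) (p (i + 1)) (p j) < 0)

/-- The undirected edges of the closed tour that visits the points with the indices
`σ 0, σ 1, …, σ (n - 1)` in this order and returns to `σ 0`. -/
def tourEdges {n : ℕ} [NeZero n] (σ : Equiv.Perm (ZMod n)) : Finset (Sym2 (ZMod n)) :=
  Finset.univ.image fun k : ZMod n => s(σ k, σ (k + 1))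

/-- A tour is an undirected closed tour through all `n` points, given by its set of edges; so
different starting points or directions of traversal give the same tour. -/
def IsTour {n : ℕ} [NeZero n] (T : Finset (Sym2 (ZMod n))) : Prop :=
  ∃ σ : Equiv.Perm (ZMod n), T = tourEdges σ

/-- The Euclidean length of an edge. -/
def edgeLength {n : ℕ} (p : ZMod n → Plane) : Sym2 (ZMod n) → ℝ :=
  Sym2.lift ⟨fun i j => dist (p i) (p j), fun i j => dist_comm (p i) (p j)⟩

/-- The total length of a set of edges. -/
def tourLength {n : ℕ} (p : ZMod n → Plane) (T : Finset (Sym2 (ZMod n))) : ℝ :=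
  ∑ e ∈ T, edgeLength p e

/-- `T'` arises from the tour `T` by a 2-exchange: for a traversal of `T`, two of the directed
edges `(a, b)` and `(c, d)` (here `a = σ k`, `b = σ (k + 1)`, `c = σ l`, `d = σ (l + 1)`) are
replaced by `(a, c)` and `(d, b)`. -/
def TwoExchange {n : ℕ} [NeZero n] (T T' : Finset (Sym2 (ZMod n))) : Prop :=
  ∃ σ : Equiv.Perm (ZMod n), T = tourEdges σ ∧ ∃ k l : ZMod n, k ≠ l ∧
    T' = (T \ {s(σ k, σ (k + 1)), s(σ l, σ (l + 1))}) ∪ {s(σ k, σ l), s(σ (l + 1), σ (k + 1))}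

/-- A tour is locally optimal (for the maximum traveling salesman problem) with respect to
2-exchanges if no 2-exchange increases its length. -/
def IsLocallyOptimal {n : ℕ} [NeZero n] (p : ZMod n → Plane) (T : Finset (Sym2 (ZMod n))) : Prop :=
  IsTour T ∧ ∀ T', TwoExchange T T' → tourLength p T' ≤ tourLength p T

/-- `T` contains the two consecutive diagonals `(p_i, p_{i+n/2})` and `(p_{i+1}, p_{i+1+n/2})`
for some `i`, and every other edge of `T` is a near-diagonal `(p_j, p_{j+n/2-1})`. -/
def IsTwoDiagonalShape {n : ℕ} (T : Finset (Sym2 (ZMod n))) : Prop :=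
  ∃ i : ZMod n,
    s(i, i + ((n / 2 : ℕ) : ZMod n)) ∈ T ∧
    s(i + 1, i + 1 + ((n / 2 : ℕ) : ZMod n)) ∈ T ∧
    ∀ e ∈ T, e ≠ s(i, i + ((n / 2 : ℕ) : ZMod n)) →
      e ≠ s(i + 1, i + 1 + ((n / 2 : ℕ) : ZMod n)) →
      ∃ j : ZMod n, e = s(j, j + ((n / 2 : ℕ) : ZMod n) - 1)

end MaxTSP

/-! ### A real RAM with a step count

Structured programs over registers and arrays that hold either machine words (natural numbers
below a bound that is linear in the input size) or exact real numbers. There is no conversion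
between real numbers and words, except through comparisons. -/

namespace RealRAM

/-- Expressions for words. -/
inductive NExp : Type
  | const (c : ℕ)
  | reg (r : ℕ)
  | get (a : ℕ) (i : NExp)
  | add (e f : NExp)
  | sub (e f : NExp)
  | mul (e f : NExp)
  | div (e f : NExp)
  | mod (e f : NExp)

/-- Expressions for real numbers. -/
inductive RExp : Type
  | const (q : ℚ)
  | reg (r : ℕ)
  | get (a : ℕ) (i : NExp)
  | add (e f : RExp)
  | sub (e f : RExp)
  | mul (e f : RExp)
  | div (e f : RExp)
  | sqrt (e : RExp)

/-- Tests: comparison of words or of real numbers. -/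
inductive BExp : Type
  | nlt (e f : NExp)
  | rlt (e f : RExp)

/-- Programs. -/
inductive Prog : Type
  | skip
  | setN (r : ℕ) (e : NExp)
  | setR (r : ℕ) (e : RExp)
  | putN (a : ℕ) (i : NExp) (e : NExp)
  | putR (a : ℕ) (i : NExp) (e : RExp)
  | seq (c d : Prog)
  | ite (b : BExp) (c d : Prog)
  | loop (b : BExp) (c : Prog)

/-- The memory: word registers, word arrays, real registers, real arrays. -/
structure State : Type where
  nreg : ℕ → ℕ
  narr : ℕ → ℕ → ℕ
  rreg : ℕ → ℝ
  rarr : ℕ → ℕ → ℝ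

/-- The value of a word expression; subtraction is truncated, and division rounds down. -/
def NExp.eval (s : State) : NExp → ℕ
  | .const c => c
  | .reg r => s.nreg r
  | .get a i => s.narr a (i.eval s)
  | .add e f => e.eval s + f.eval s
  | .sub e f => e.eval s - f.eval s
  | .mul e f => e.eval s * f.eval s
  | .div e f => e.eval s / f.eval s
  | .mod e f => e.eval s % f.eval s

/-- The value of a real expression. -/
def RExp.eval (s : State) : RExp → ℝ
  | .const q => (q : ℝ)
  | .reg r => s.rreg r
  | .get a i => s.rarr a (i.eval s)
  | .add e f => e.eval s + f.eval s
  | .sub e f => e.eval s - f.eval s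
  | .mul e f => e.eval s * f.eval s
  | .div e f => e.eval s / f.eval s
  | .sqrt e => Real.sqrt (e.eval s)

/-- The truth of a test. -/
def BExp.Holds (s : State) : BExp → Prop
  | .nlt e f => e.eval s < f.eval s
  | .rlt e f => e.eval s < f.eval s

/-- The cost of evaluating an expression: one step for every operation, constant and access. -/
def NExp.cost : NExp → ℕ
  | .const _ => 1
  | .reg _ => 1
  | .get _ i => i.cost + 1
  | .add e f => e.cost + f.cost + 1
  | .sub e f => e.cost + f.cost + 1
  | .mul e f => e.cost + f.cost + 1
  | .div e f => e.cost + f.cost + 1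
  | .mod e f => e.cost + f.cost + 1

/-- The cost of evaluating an expression for real numbers. -/
def RExp.cost : RExp → ℕ
  | .const _ => 1
  | .reg _ => 1
  | .get _ i => i.cost + 1
  | .add e f => e.cost + f.cost + 1
  | .sub e f => e.cost + f.cost + 1
  | .mul e f => e.cost + f.cost + 1
  | .div e f => e.cost + f.cost + 1
  | .sqrt e => e.cost + 1

/-- The cost of evaluating a test. -/
def BExp.cost : BExp → ℕ
  | .nlt e f => e.cost + f.cost + 1
  | .rlt e f => e.cost + f.cost + 1

/-- `Exec W c s s' t`: started in the memory `s`, the program `c` halts in the memory `s'` after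
exactly `t` steps, and all the words that it stores and all the addresses that it writes to are
at most `W`. -/
inductive Exec (W : ℕ) : Prog → State → State → ℕ → Prop
  | skip (s : State) : Exec W .skip s s 1
  | setN (r : ℕ) (e : NExp) (s : State) (he : e.eval s ≤ W) :
      Exec W (.setN r e) s
        { s with nreg := Function.update s.nreg r (e.eval s) } (e.cost + 1)
  | setR (r : ℕ) (e : RExp) (s : State) :
      Exec W (.setR r e) s
        { s with rreg := Function.update s.rreg r (e.eval s) } (e.cost + 1)
  | putN (a : ℕ) (i e : NExp) (s : State) (hi : i.eval s ≤ W) (he : e.eval s ≤ W) :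
      Exec W (.putN a i e) s
        { s with narr := Function.update s.narr a
                   (Function.update (s.narr a) (i.eval s) (e.eval s)) }
        (i.cost + e.cost + 1)
  | putR (a : ℕ) (i : NExp) (e : RExp) (s : State) (hi : i.eval s ≤ W) :
      Exec W (.putR a i e) s
        { s with rarr := Function.update s.rarr a
                   (Function.update (s.rarr a) (i.eval s) (e.eval s)) }
        (i.cost + e.cost + 1)
  | seq {c d : Prog} {s s' s'' : State} {t u : ℕ} (hc : Exec W c s s' t)
      (hd : Exec W d s' s'' u) : Exec W (.seq c d) s s'' (t + u)
  | ite_true {b : BExp} {c d : Prog} {s s' : State} {t : ℕ} (hb : b.Holds s)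
      (hc : Exec W c s s' t) : Exec W (.ite b c d) s s' (b.cost + t)
  | ite_false {b : BExp} {c d : Prog} {s s' : State} {t : ℕ} (hb : ¬ b.Holds s)
      (hd : Exec W d s s' t) : Exec W (.ite b c d) s s' (b.cost + t)
  | loop_true {b : BExp} {c : Prog} {s s' s'' : State} {t u : ℕ} (hb : b.Holds s)
      (hc : Exec W c s s' t) (hl : Exec W (.loop b c) s' s'' u) :
      Exec W (.loop b c) s s'' (b.cost + t + u)
  | loop_false {b : BExp} {c : Prog} {s : State} (hb : ¬ b.Holds s) :
      Exec W (.loop b c) s s b.cost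

end RealRAM

namespace MaxTSP

/-- The input: the number `n` of points in word register `0`, the coordinates of
`p 0, …, p (n - 1)` in the entries `0, …, n - 1` of the real arrays `0` and `1`, and zero
everywhere else. -/
def inputState {n : ℕ} (p : ZMod n → Plane) : RealRAM.State where
  nreg := fun r => if r = 0 then n else 0
  narr := fun _ _ => 0
  rreg := fun _ => 0
  rarr := fun a k =>
    if k < n then
      if a = 0 then p (k : ZMod n) 0 else if a = 1 then p (k : ZMod n) 1 else 0
    else 0

/-- The entries `0, …, n - 1` of the word array `0` list the indices, in `{0, …, n - 1}`, of the
points in the order in which the tour `T` visits them. -/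
def OutputsTour {n : ℕ} [NeZero n] (s : RealRAM.State) (T : Finset (Sym2 (ZMod n))) : Prop :=
  ∃ σ : Equiv.Perm (ZMod n), (∀ k : ZMod n, s.narr 0 k.val = (σ k).val) ∧ T = tourEdges σ

end MaxTSP

end

/-! Write n = 2m and direct the tour. In a strictly convex quadrilateral the diagonals together
exceed either pair of opposite sides (`IsConvexPolygon.quadrangle`). If two disjoint, non-crossing
edges run around the polygon in the same sense, a 2-exchange replaces opposite sides by diagonals,
so local optimality forbids such pairs. Let the edge out of x end at x + m + t x. The prohibition
becomes two inequalities on the deviation t (`IsLocallyOptimal.le_deviation`,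
`IsLocallyOptimal.deviation_le`). With injectivity of the successor map they give |t x| ≤ 1: a
maximum k ≥ 2 would trap all values in k - 2, ..., k (`deviation_le_one`), while a vertex opposite
the maximum must have a negative value.

Once |t| ≤ 1, the successor map is a half-turn composed with swaps of disjoint pairs of neighbours.
Connectedness then determines the tour (`tourEdges_subset_ladderEdges`). Call g a gap if neither g -
1, g nor the opposite two vertices are swapped. Without a gap the tour would never leave the
vertices with t = 1; with two gaps that are not opposite, the vertices between them would be closed
under successors. So the gap is unique up to the half-turn and the tour is the ladder with diagonals
at g - 1 and g. Ladders have period m in their index, whence the bound n / 2.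

A 2-exchange yields a tour, so a longest tour is locally optimal and hence a ladder. Its length is a
constant plus `gain`, a combination of four distances (`tourLength_ladderEdges`). Comparing m gains
and writing out an explicit traversal of the best ladder takes linear time. -/

namespace MaxTSP

/-! ### Convex position and the quadrangle inequalities -/

/-- If all other vertices lie strictly on one side of every side of a polygon, then all triples of
vertices in cyclic order have the same orientation. -/
theorem orient_triple_pos {n : ℕ} [NeZero n] {p : ZMod n → Plane} {c : ℝ}
    (h : ∀ i j : ZMod n, j ≠ i → j ≠ i + 1 → 0 < c * orient (p i) (p (i + 1)) (p j))
    (a : ZMod n) {j k : ℕ} (hj : 0 < j) (hjk : j < k) (hk : k < n) :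
    0 < c * orient (p a) (p (a + j)) (p (a + k)) := by
  have hcast : ∀ u v : ℕ, u < n → v < n → u ≠ v → a + (u : ZMod n) ≠ a + v := by
    intro u v hu hv huv he
    apply huv
    have := add_left_cancel he
    have h2 := congrArg ZMod.val this
    rwa [ZMod.val_natCast_of_lt hu, ZMod.val_natCast_of_lt hv] at h2
  have h1 : ∀ k : ℕ, 2 ≤ k → k < n → 0 < c * orient (p a) (p (a + 1)) (p (a + k)) := by
    intro k h2 hk
    apply h
    · simpa using hcast k 0 hk (by omega) (by omega)
    · simpa using hcast k 1 hk (by omega) (by omega)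
  -- The side at a + k sees the vertex a; a cyclic rotation of the triangle puts a first.
  have h2 : ∀ k : ℕ, 1 ≤ k → k + 1 < n →
      0 < c * orient (p a) (p (a + k)) (p (a + (k + 1 : ℕ))) := by
    intro k h1 hk
    have := h (a + k) a
      (by simpa using hcast 0 k (by omega) (by omega) (by omega))
      (by simpa [add_assoc] using hcast 0 (k + 1) (by omega) (by omega) (by omega))
    have e : a + ((k + 1 : ℕ) : ZMod n) = a + k + 1 := by push_cast; ring
    rw [e]
    convert this using 2
    unfold orient; ring
  induction k, hjk using Nat.le_induction with
  | base => exact h2 j hj hk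
  | succ k hjk ih =>
    have hjk' : j < k := hjk
    have ih := ih (by omega)
    have e3 := h2 k (by omega) hk
    have e1 := h1 k (by omega) (by omega)
    have e2 := h1 (k + 1) (by omega) hk
    rcases eq_or_lt_of_le (show 1 ≤ j from hj) with rfl | hj1
    · simpa using e2
    have e4 := h1 j (by omega) (by omega)
    -- Three-term Plücker relation for the vectors from p a. The right-hand side is positive, and so
    -- is the first factor on the left.
    have key : (c * orient (p a) (p (a + 1)) (p (a + k))) *
        (c * orient (p a) (p (a + j)) (p (a + (k + 1 : ℕ)))) =
        (c * orient (p a) (p (a + 1)) (p (a + j))) *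
          (c * orient (p a) (p (a + k)) (p (a + (k + 1 : ℕ)))) +
        (c * orient (p a) (p (a + 1)) (p (a + (k + 1 : ℕ)))) *
          (c * orient (p a) (p (a + j)) (p (a + k))) := by
      unfold orient; ring
    have : 0 < (c * orient (p a) (p (a + 1)) (p (a + k))) *
        (c * orient (p a) (p (a + j)) (p (a + (k + 1 : ℕ)))) := by
      rw [key]; positivity
    exact (pos_iff_pos_of_mul_pos this).1 e1

theorem orient_eq_zero_of_wbtw {A P B : Plane} (h : Wbtw ℝ A P B) : orient A B P = 0 := by
  obtain ⟨r, -, rfl⟩ := h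
  simp [orient, AffineMap.lineMap_apply]
  ring

/-- The strict triangle inequality for a point off the line. -/
theorem dist_lt_of_orient_ne_zero {A P B : Plane} (h : orient A B P ≠ 0) :
    dist A B < dist A P + dist P B := by
  refine lt_of_le_of_ne (dist_triangle _ _ _) fun he => h ?_
  exact orient_eq_zero_of_wbtw (dist_add_dist_eq_iff.1 he.symm)

/-- In a strictly convex quadrilateral the diagonals are together longer than two opposite
sides. -/
theorem dist_add_dist_lt_diagonals {A B C D : Plane} {c : ℝ}
    (hABC : 0 < c * orient A B C) (hACD : 0 < c * orient A C D)
    (hABD : 0 < c * orient A B D) (hBCD : 0 < c * orient B C D) :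
    dist A B + dist C D < dist A C + dist B D ∧ dist A D + dist B C < dist A C + dist B D := by
  set α := c * orient A B C with hα
  set β := c * orient A C D with hβ
  set γ := c * orient A B D with hγ
  set δ := c * orient B C D with hδ
  have hsum : α + β = γ + δ := by simp only [hα, hβ, hγ, hδ, orient]; ring
  have hs : 0 < γ + δ := by positivity
  -- The intersection of the diagonals: each diagonal is divided in the ratio of the areas of the
  -- triangles that the other one cuts off.
  set P : Plane := AffineMap.lineMap A C (γ / (γ + δ)) with hP
  have hP2 : P = AffineMap.lineMap B D (α / (γ + δ)) := by
    have hne := hs.ne'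
    ext i
    have e : ∀ (X Y : Plane) (r : ℝ), (AffineMap.lineMap X Y r : Plane) i
        = r * (Y i - X i) + X i := by
      intro X Y r; simp [AffineMap.lineMap_apply]
    rw [hP, e, e]
    field_simp
    have hi : ∀ i, γ * (C i - A i) + (γ + δ) * A i = α * (D i - B i) + (γ + δ) * B i := by
      rw [Fin.forall_fin_two]
      constructor <;> simp only [hα, hγ, hδ, orient] <;> ring
    linarith [hi i]
  have w1 : Wbtw ℝ A P C :=
    ⟨_, ⟨by positivity, by rw [div_le_one hs]; linarith⟩, rfl⟩
  have w2 : Wbtw ℝ B P D := by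
    rw [hP2]
    exact ⟨_, ⟨by positivity, by rw [div_le_one hs]; linarith⟩, rfl⟩
  have d1 := dist_add_dist_eq_iff.2 w1
  have d2 := dist_add_dist_eq_iff.2 w2
  have hcoord : ∀ i, P i = γ / (γ + δ) * (C i - A i) + A i := by
    intro i; rw [hP]; simp [AffineMap.lineMap_apply]
  have o1 : c * orient A B P = γ / (γ + δ) * α := by
    simp only [hα, orient, hcoord]; ring
  have o2 : c * orient A D P = - (γ / (γ + δ) * β) := by
    simp only [hβ, orient, hcoord]; ring
  have s1 : dist A B < dist A P + dist P B := by
    apply dist_lt_of_orient_ne_zero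
    intro h0; rw [h0] at o1
    have : 0 < γ / (γ + δ) * α := by positivity
    linarith
  have s2 : dist A D < dist A P + dist P D := by
    apply dist_lt_of_orient_ne_zero
    intro h0; rw [h0] at o2
    have : 0 < γ / (γ + δ) * β := by positivity
    linarith
  have t1 := dist_triangle C P D
  have t2 := dist_triangle B P C
  rw [dist_comm C P] at t1
  rw [dist_comm P B] at s1
  constructor <;> linarith

/-- The sign c treats counterclockwise and clockwise polygons together. -/
theorem IsConvexPolygon.exists_sign {n : ℕ} {p : ZMod n → Plane} (h : IsConvexPolygon p) :
    ∃ c : ℝ, ∀ i j : ZMod n, j ≠ i → j ≠ i + 1 → 0 < c * orient (p i) (p (i + 1)) (p j) := by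
  rcases h with h | h
  · exact ⟨1, fun i j h1 h2 => by simpa using h i j h1 h2⟩
  · exact ⟨-1, fun i j h1 h2 => by simpa using h i j h1 h2⟩

/-- The quadrangle inequalities for four vertices of a convex polygon in cyclic order. -/
theorem IsConvexPolygon.quadrangle {n : ℕ} [NeZero n] {p : ZMod n → Plane}
    (h : IsConvexPolygon p) (a : ZMod n) {i j k : ℕ} (hi : 0 < i) (hij : i < j) (hjk : j < k)
    (hk : k < n) :
    dist (p a) (p (a + i)) + dist (p (a + j)) (p (a + k)) <
        dist (p a) (p (a + j)) + dist (p (a + i)) (p (a + k)) ∧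
      dist (p a) (p (a + k)) + dist (p (a + i)) (p (a + j)) <
        dist (p a) (p (a + j)) + dist (p (a + i)) (p (a + k)) := by
  obtain ⟨c, hc⟩ := h.exists_sign
  refine dist_add_dist_lt_diagonals (c := c) (orient_triple_pos hc a hi hij (by omega))
    (orient_triple_pos hc a (by omega) hjk hk) (orient_triple_pos hc a hi (by omega) hk) ?_
  have := orient_triple_pos hc (a + i) (j := j - i) (k := k - i) (by omega) (by omega) (by omega)
  have e : ∀ l : ℕ, i < l → a + (i : ZMod n) + ((l - i : ℕ) : ZMod n) = a + l := by
    intro l hl; rw [Nat.cast_sub hl.le]; ring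
  rwa [e j hij, e k (by omega)] at this

end MaxTSP

/-! ### Tours, successors and 2-exchanges -/

namespace MaxTSP

section Tours

variable {n : ℕ}

/-- A repeated edge would have to be traversed in both directions, which forces 2 = 0 in `ZMod n`.
-/
theorem edge_injective (hn : 3 ≤ n) (σ : Equiv.Perm (ZMod n)) :
    Function.Injective fun k : ZMod n => s(σ k, σ (k + 1)) := by
  intro k l h
  rcases Sym2.eq_iff.1 h with ⟨h1, -⟩ | ⟨h1, h2⟩
  · exact σ.injective h1
  · have h1 := σ.injective h1
    have h2 := σ.injective h2
    exfalso
    have h3 : ((2 : ℕ) : ZMod n) = 0 := by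
      rw [h1] at h2; push_cast; linear_combination h2
    have := Nat.le_of_dvd (by norm_num) ((ZMod.natCast_eq_zero_iff 2 n).1 h3)
    omega

/-- The successor of a vertex in the traversal `σ`. -/
def succ (σ : Equiv.Perm (ZMod n)) (x : ZMod n) : ZMod n := σ (σ.symm x + 1)

theorem succ_injective (σ : Equiv.Perm (ZMod n)) : Function.Injective (succ σ) := by
  intro x y h
  exact σ.symm.injective (add_right_cancel (σ.injective h))

theorem succ_ne (hn : 2 ≤ n) (σ : Equiv.Perm (ZMod n)) (x : ZMod n) : succ σ x ≠ x := by
  intro h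
  have : Fact (1 < n) := ⟨hn⟩
  have h1 : σ.symm x + 1 = σ.symm x := σ.injective (by simpa [succ] using h)
  simp at h1

variable [NeZero n]

theorem card_tourEdges (hn : 3 ≤ n) (σ : Equiv.Perm (ZMod n)) : (tourEdges σ).card = n := by
  rw [tourEdges, Finset.card_image_of_injective _ (edge_injective hn σ), Finset.card_univ,
    ZMod.card]

theorem edge_mem_tourEdges (σ : Equiv.Perm (ZMod n)) (k : ZMod n) :
    s(σ k, σ (k + 1)) ∈ tourEdges σ :=
  Finset.mem_image_of_mem _ (Finset.mem_univ k)

theorem mk_mem_tourEdges_iff (σ : Equiv.Perm (ZMod n)) (k l : ZMod n) :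
    s(σ k, σ l) ∈ tourEdges σ ↔ l = k + 1 ∨ k = l + 1 := by
  constructor
  · intro h
    obtain ⟨j, -, hj⟩ := Finset.mem_image.1 h
    rcases Sym2.eq_iff.1 hj with ⟨h1, h2⟩ | ⟨h1, h2⟩
    · left; rw [← σ.injective h1, σ.injective h2]
    · right; rw [← σ.injective h1, σ.injective h2]
  · rintro (rfl | rfl)
    · exact edge_mem_tourEdges σ k
    · rw [Sym2.eq_swap]; exact edge_mem_tourEdges σ l

/-- Reversal of the initial segment `0, …, j`. -/
def reverseFun (j x : ZMod n) : ZMod n := if x.val ≤ j.val then j - x else x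

theorem reverseFun_involutive (j : ZMod n) : Function.Involutive (reverseFun j) := by
  intro x
  unfold reverseFun
  by_cases h : x.val ≤ j.val
  · rw [if_pos h, if_pos (by rw [ZMod.val_sub h]; omega)]; ring
  · rw [if_neg h, if_neg h]

/-- Reversal of the initial segment `0, …, j` as a permutation. -/
def reversePerm (j : ZMod n) : Equiv.Perm (ZMod n) := (reverseFun_involutive j).toPerm

theorem reversePerm_of_le {j x : ZMod n} (h : x.val ≤ j.val) : reversePerm j x = j - x :=
  if_pos h

theorem reversePerm_of_lt {j x : ZMod n} (h : j.val < x.val) : reversePerm j x = x :=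
  if_neg (by omega)

theorem val_add_one_of_ne {x : ZMod n} (hn : 2 ≤ n) (h : x ≠ -1) : (x + 1).val = x.val + 1 := by
  have : Fact (1 < n) := ⟨hn⟩
  have hlt : x.val + 1 < n := by
    rcases Nat.lt_or_ge (x.val + 1) n with h1 | h1
    · exact h1
    · exfalso; apply h
      have := ZMod.val_lt x
      have h2 : x.val + 1 = n := by omega
      have h3 : ((x.val + 1 : ℕ) : ZMod n) = 0 := by rw [h2]; simp
      push_cast [ZMod.natCast_zmod_val] at h3
      linear_combination h3
  rw [ZMod.val_add, ZMod.val_one, Nat.mod_eq_of_lt hlt]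

theorem val_neg_one (hn : 2 ≤ n) : (-1 : ZMod n).val = n - 1 := by
  obtain ⟨k, rfl⟩ : ∃ k, n = k + 1 := ⟨n - 1, by omega⟩
  exact ZMod.val_neg_one k

/-- A 2-exchange turns a tour into a tour. -/
theorem TwoExchange.isTour (hn : 3 ≤ n) {T T' : Finset (Sym2 (ZMod n))} (h : TwoExchange T T') :
    IsTour T' := by
  obtain ⟨σ, rfl, k, l, hkl, rfl⟩ := h
  -- Rotating the traversal puts the first removed edge between the positions -1 and 0 and the
  -- second between j and j + 1.
  set τ : Equiv.Perm (ZMod n) := (Equiv.addLeft (k + 1)).trans σ with hτ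
  set j : ZMod n := l - (k + 1) with hj
  have τa : ∀ x, τ x = σ (k + 1 + x) := fun x => rfl
  have hτE : tourEdges σ = tourEdges τ := by
    ext e
    simp only [tourEdges, Finset.mem_image, Finset.mem_univ, true_and, τa]
    constructor
    · rintro ⟨x, rfl⟩
      exact ⟨x - (k + 1), by congr 2 <;> ring⟩
    · rintro ⟨x, rfl⟩
      exact ⟨k + 1 + x, by rw [add_assoc (k + 1) x 1]⟩
  have e1 : σ k = τ (-1) := by rw [τa]; congr 1; ring
  have e2 : σ (k + 1) = τ (-1 + 1) := by rw [τa]; congr 1; ring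
  have e3 : σ l = τ j := by rw [τa, hj]; congr 1; ring
  have e4 : σ (l + 1) = τ (j + 1) := by rw [τa, hj]; congr 1; ring
  have hj1 : j ≠ -1 := by
    intro h0; apply hkl; rw [hj] at h0; linear_combination -h0
  rw [hτE, e1, e2, e3, e4]
  -- The new cyclic order is j, ..., 1, 0, j + 1, ..., n - 1. One inclusion suffices, since the
  -- exchanged set has at most (n - 2) + 2 edges.
  refine ⟨(reversePerm j).trans τ, ?_⟩
  symm
  apply Finset.eq_of_subset_of_card_le
  · intro e he
    obtain ⟨x, -, rfl⟩ := Finset.mem_image.1 he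
    simp only [Equiv.trans_apply]
    have hinj := edge_injective hn τ
    have keep : ∀ y, y ≠ -1 → y ≠ j → s(τ y, τ (y + 1)) ∈
        tourEdges τ \ {s(τ (-1), τ (-1 + 1)), s(τ j, τ (j + 1))} ∪
        {s(τ (-1), τ j), s(τ (j + 1), τ (-1 + 1))} := by
      intro y h1 h2
      refine Finset.mem_union_left _ (Finset.mem_sdiff.2 ⟨edge_mem_tourEdges τ y, ?_⟩)
      rw [Finset.mem_insert, Finset.mem_singleton]
      rintro (h3 | h3)
      · exact h1 (hinj h3)
      · exact h2 (hinj h3)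
    have hj2 := val_add_one_of_ne (by omega) hj1
    by_cases hx : x = -1
    · subst hx
      have v1 := val_neg_one (n := n) (by omega)
      have := ZMod.val_lt (j + 1)
      rw [reversePerm_of_lt (by omega), reversePerm_of_le (by simp)]
      simp
    · have hx1 := val_add_one_of_ne (by omega) hx
      rcases lt_trichotomy x.val j.val with h | h | h
      · rw [reversePerm_of_le h.le, reversePerm_of_le (by omega),
          show j - x = j - (x + 1) + 1 by ring,
          Sym2.eq_swap (a := τ (j - (x + 1) + 1)) (b := τ (j - (x + 1)))]
        exact keep (j - (x + 1)) (by intro h0; apply h.ne; congr 1; linear_combination -h0)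
          (by intro h0; apply hx; linear_combination -h0)
      · obtain rfl : x = j := ZMod.val_injective n h
        rw [reversePerm_of_le le_rfl, reversePerm_of_lt (by omega)]
        rw [Sym2.eq_swap]; simp
      · rw [reversePerm_of_lt h, reversePerm_of_lt (by omega)]
        exact keep x hx (by rintro rfl; omega)
  · rw [card_tourEdges hn]
    refine (Finset.card_union_le _ _).trans ?_
    rw [Finset.card_sdiff_of_subset, card_tourEdges hn, Finset.card_pair]
    · have := Finset.card_le_two (a := s(τ (-1), τ j)) (b := s(τ (j + 1), τ (-1 + 1)))
      omega
    · intro h0; exact hj1 (edge_injective hn τ h0).symm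
    · intro e he
      rw [Finset.mem_insert, Finset.mem_singleton] at he
      rcases he with rfl | rfl <;> exact edge_mem_tourEdges τ _

theorem mem_tourEdges_iff_succ (σ : Equiv.Perm (ZMod n)) (e : Sym2 (ZMod n)) :
    e ∈ tourEdges σ ↔ ∃ x, e = s(x, succ σ x) := by
  simp only [tourEdges, Finset.mem_image, Finset.mem_univ, true_and, succ]
  constructor
  · rintro ⟨k, rfl⟩; exact ⟨σ k, by simp⟩
  · rintro ⟨x, rfl⟩; exact ⟨σ.symm x, by simp⟩

/-- A nonempty set of vertices that is closed under successors contains all vertices. -/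
theorem mem_of_succ_closed (σ : Equiv.Perm (ZMod n)) (S : Set (ZMod n)) {x : ZMod n}
    (hx : x ∈ S) (hS : ∀ y ∈ S, succ σ y ∈ S) (y : ZMod n) : y ∈ S := by
  have key : ∀ k : ℕ, σ (σ.symm x + k) ∈ S := by
    intro k
    induction k with
    | zero => simpa using hx
    | succ k ih =>
      have := hS _ ih
      simpa [succ, add_assoc] using this
  have := key (σ.symm y - σ.symm x).val
  simpa using this

/-- In a locally optimal tour, no exchange of two disjoint edges is profitable. -/
theorem IsLocallyOptimal.dist_add_dist_le (hn : 3 ≤ n) {p : ZMod n → Plane}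
    {σ : Equiv.Perm (ZMod n)} (h : IsLocallyOptimal p (tourEdges σ)) {x y : ZMod n}
    (hxy : x ≠ y) (h1 : succ σ x ≠ y) (h2 : succ σ y ≠ x) :
    dist (p x) (p y) + dist (p (succ σ x)) (p (succ σ y)) ≤
      dist (p x) (p (succ σ x)) + dist (p y) (p (succ σ y)) := by
  obtain ⟨k, rfl⟩ := σ.surjective x
  obtain ⟨l, rfl⟩ := σ.surjective y
  simp only [succ, Equiv.symm_apply_apply] at *
  have hkl : k ≠ l := fun h => hxy (by rw [h])
  have hk1 : k + 1 ≠ l := fun h => h1 (by rw [h])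
  have hl1 : l + 1 ≠ k := fun h => h2 (by rw [h])
  have hle := h.2 _ ⟨σ, rfl, k, l, hkl, rfl⟩
  have hinj := edge_injective hn σ
  have hn1 : s(σ k, σ l) ∉ tourEdges σ := by
    rw [mk_mem_tourEdges_iff]; tauto
  have hn2 : s(σ (l + 1), σ (k + 1)) ∉ tourEdges σ := by
    rw [mk_mem_tourEdges_iff]
    rintro (h | h)
    · exact hl1 (add_right_cancel h).symm
    · exact hk1 (add_right_cancel h).symm
  have hne : s(σ k, σ l) ≠ s(σ (l + 1), σ (k + 1)) := by
    intro h
    rcases Sym2.eq_iff.1 h with ⟨h, -⟩ | ⟨h, -⟩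
    · exact hl1 (σ.injective h).symm
    · have : Fact (1 < n) := ⟨by omega⟩
      have h := σ.injective h
      simp at h
  have hsub : ({s(σ k, σ (k + 1)), s(σ l, σ (l + 1))} : Finset (Sym2 (ZMod n))) ⊆
      tourEdges σ := by
    intro e he
    rw [Finset.mem_insert, Finset.mem_singleton] at he
    rcases he with rfl | rfl <;> exact edge_mem_tourEdges σ _
  have hsd := Finset.sum_sdiff (f := edgeLength p) hsub
  rw [Finset.sum_pair (fun h => hkl (hinj h))] at hsd
  unfold tourLength at hle
  rw [Finset.sum_union, Finset.sum_pair hne, ← hsd] at hle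
  · have hE : ∀ a b, edgeLength p s(a, b) = dist (p a) (p b) := fun a b => rfl
    simp only [hE] at hle
    rw [dist_comm (p (σ (l + 1)))] at hle
    linarith
  · rw [Finset.disjoint_right]
    intro e he he2
    rw [Finset.mem_insert, Finset.mem_singleton] at he
    rcases he with rfl | rfl
    · exact hn1 (Finset.mem_sdiff.1 he2).1
    · exact hn2 (Finset.mem_sdiff.1 he2).1

/-- A longest tour is locally optimal. -/
theorem isLocallyOptimal_of_longest (hn : 3 ≤ n) {p : ZMod n → Plane}
    {T : Finset (Sym2 (ZMod n))} (hT : IsTour T)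
    (h : ∀ T', IsTour T' → tourLength p T' ≤ tourLength p T) : IsLocallyOptimal p T :=
  ⟨hT, fun T' h' => h T' (h'.isTour hn)⟩

theorem exists_longest_tour (p : ZMod n → Plane) :
    ∃ T, IsTour T ∧ ∀ T', IsTour T' → tourLength p T' ≤ tourLength p T := by
  obtain ⟨σ, hσ⟩ := Finite.exists_max fun σ : Equiv.Perm (ZMod n) => tourLength p (tourEdges σ)
  refine ⟨_, ⟨σ, rfl⟩, ?_⟩
  rintro _ ⟨τ, rfl⟩
  exact hσ τ

end Tours

end MaxTSP

/-! ### Bounding the deviation from a diagonal -/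

namespace MaxTSP

section Deviation

variable {n m : ℕ}

theorem half_add_half (hn : n = 2 * m) : (m : ZMod n) + m = 0 := by
  have : ((2 * m : ℕ) : ZMod n) = 0 := by rw [← hn]; simp
  push_cast at this
  linear_combination this

theorem natCast_ne_zero_of_lt {k : ℕ} (hk : 0 < k) (hkn : k < n) : (k : ZMod n) ≠ 0 := by
  rw [Ne, ZMod.natCast_eq_zero_iff]
  exact fun h => absurd (Nat.le_of_dvd hk h) (by omega)

variable [NeZero n] {t : ZMod n → ℤ}

/-- If the edge from `x` to `x + m + t x` crosses or is co-directed with every other edge, then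
no edge is more than one step longer than a diagonal. -/
theorem deviation_le_one (hn : n = 2 * m) (hm : 2 ≤ m) (hlt : ∀ x, |t x| < m)
    (hinj : ∀ x y : ZMod n, x + (t x : ZMod n) = y + (t y : ZMod n) → x = y)
    (h1 : ∀ (x : ZMod n) (j : ℤ), |j| < m → t x < j → -j ≤ t (x + m + j))
    (h2 : ∀ (x : ZMod n) (j : ℤ), |j| < m → j < t x → t (x + m + j) ≤ -j) (x : ZMod n) :
    t x ≤ 1 := by
  have hmm := half_add_half hn
  have z1 : (1 : ZMod n) ≠ 0 := by
    simpa using natCast_ne_zero_of_lt (n := n) (k := 1) (by omega) (by omega)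
  have z2 : (2 : ZMod n) ≠ 0 := by
    simpa using natCast_ne_zero_of_lt (n := n) (k := 2) (by omega) (by omega)
  have z3 : (3 : ZMod n) ≠ 0 := by
    simpa using natCast_ne_zero_of_lt (n := n) (k := 3) (by omega) (by omega)
  obtain ⟨x₀, hmax⟩ := Finite.exists_max t
  obtain ⟨k, hk⟩ : ∃ k, t x₀ = k := ⟨_, rfl⟩
  rw [hk] at hmax
  refine (hmax x).trans ?_
  by_contra! hk2
  have hkm : k < m := by have := hlt x₀; rw [hk, abs_lt] at this; omega
  -- Let y be the vertex just before the end of the edge from x. `h2` keeps the edge from y from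
  -- ending beyond x; then `h1`, applied at y, makes the edge from x + i end at y or later.
  have back : ∀ (x : ZMod n) (i : ℤ), 1 ≤ t x → 0 < i → |i + 1 - t x| < m →
      t x - i - 1 ≤ t (x + i) := by
    intro x i hx hi hi2
    have := hlt x
    rw [abs_lt] at this
    have a := h2 x (t x - 1) (by rw [abs_lt]; omega) (by omega)
    have b := h1 _ (i + 1 - t x) hi2 (lt_of_le_of_lt a (by omega))
    have e : x + m + ((t x - 1 : ℤ) : ZMod n) + m + ((i + 1 - t x : ℤ) : ZMod n) = x + i := by
      push_cast; linear_combination hmm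
    rw [e] at b
    omega
  have step1 : ∀ x, 1 ≤ t x → t x - 2 ≤ t (x + 1) := by
    intro x hx
    have := hmax x
    have := back x 1 hx (by omega) (by rw [abs_lt]; omega)
    push_cast at this
    omega
  have step2 : ∀ x, t x = k → k - 3 ≤ t (x + 2) := by
    intro x hx
    have := back x 2 (by omega) (by omega) (by rw [abs_lt]; omega)
    push_cast at this
    omega
  have opp : ∀ x, t x = k → t (x + m + 1) ≤ -1 := by
    intro x hx
    simpa using h2 x 1 (by rw [abs_lt]; omega) (by omega)
  have cover : ∀ x y : ZMod n, ∃ i : ℕ, x + i = y := by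
    intro x y
    exact ⟨(y - x).val, by simp⟩
  -- After two consecutive maxima, `step1` leaves k - 2, k - 1 and k, and the ends for the first two
  -- are taken. So k would persist all the way around, against `opp`.
  have nokk : ∀ x, t x = k → t (x + 1) ≠ k := by
    intro x hx hx1
    have all : ∀ i : ℕ, t (x + i) = k ∧ t (x + i + 1) = k := by
      intro i
      induction i with
      | zero => simpa using ⟨hx, hx1⟩
      | succ i ih =>
        obtain ⟨ih1, ih2⟩ := ih
        have e : x + ((i + 1 : ℕ) : ZMod n) = x + i + 1 := by push_cast; ring
        rw [e]
        refine ⟨ih2, ?_⟩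
        generalize x + (i : ZMod n) = y at ih1 ih2
        have a := step1 (y + 1) (by omega)
        have b := hmax (y + 1 + 1)
        have c : t (y + 1 + 1) ≠ k - 2 := by
          intro h
          have := hinj (y + 1 + 1) y (by rw [h, ih1]; push_cast; ring)
          exact z2 (by linear_combination this)
        have d : t (y + 1 + 1) ≠ k - 1 := by
          intro h
          have := hinj (y + 1 + 1) (y + 1) (by rw [h, ih2]; push_cast; ring)
          exact z1 (by linear_combination this)
        omega
    obtain ⟨i, hi⟩ := cover x (x + m + 1)
    have := (all i).1
    rw [hi] at this
    have := opp x hx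
    omega
  -- Lower bounds come from `step1` and `step2`, and injectivity removes values whose end is already
  -- taken. The remembered earlier values are exactly those needed to do so. All three cases give t
  -- ≥ k - 2 ≥ 0, against `opp`.
  have inv : ∀ i : ℕ, t (x₀ + i) = k ∨ (t (x₀ + i) = k - 2 ∧ t (x₀ + i - 1) = k) ∨
      (t (x₀ + i) = k - 1 ∧ (t (x₀ + i - 1) = k - 1 ∨ t (x₀ + i - 2) = k)) := by
    intro i
    induction i with
    | zero => left; simpa using hk
    | succ i ih =>
      have e : x₀ + ((i + 1 : ℕ) : ZMod n) = x₀ + i + 1 := by push_cast; ring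
      rw [e]
      generalize x₀ + (i : ZMod n) = y at ih
      have e1 : y + 1 - 1 = y := by ring
      have e2 : y + 1 - 2 = y - 1 := by ring
      rw [e1, e2]
      have b := hmax (y + 1)
      rcases ih with ih | ⟨ih, ih1⟩ | ⟨ih, ih1⟩
      · have a := step1 y (by omega)
        have c := nokk y ih
        have d : t (y + 1) ≠ k - 1 := by
          intro h
          have := hinj (y + 1) y (by rw [h, ih]; push_cast; ring)
          exact z1 (by linear_combination this)
        omega
      · have a := step2 (y - 1) ih1
        rw [show y - 1 + 2 = y + 1 by ring] at a
        have c : t (y + 1) ≠ k - 3 := by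
          intro h
          have := hinj (y + 1) y (by rw [h, ih]; push_cast; ring)
          exact z1 (by linear_combination this)
        have d : t (y + 1) ≠ k - 2 := by
          intro h
          have := hinj (y + 1) (y - 1) (by rw [h, ih1]; push_cast; ring)
          exact z2 (by linear_combination this)
        omega
      · have a := step1 y (by omega)
        have c : t (y + 1) ≠ k - 2 := by
          intro h
          have := hinj (y + 1) y (by rw [h, ih]; push_cast; ring)
          exact z1 (by linear_combination this)
        have d : t (y + 1) ≠ k - 3 := by
          intro h
          rcases ih1 with ih1 | ih1
          · have := hinj (y + 1) (y - 1) (by rw [h, ih1]; push_cast; ring)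
            exact z2 (by linear_combination this)
          · have := hinj (y + 1) (y - 2) (by rw [h, ih1]; push_cast; ring)
            exact z3 (by linear_combination this)
        omega
  obtain ⟨i, hi⟩ := cover x₀ (x₀ + m + 1)
  have a := inv i
  rw [hi] at a
  have b := opp x₀ hk
  omega

/-- The reflection x ↦ -x negates deviations and interchanges `h1` and `h2`, so the upper bound
yields the lower one. -/
theorem abs_deviation_le_one (hn : n = 2 * m) (hm : 2 ≤ m) (hlt : ∀ x, |t x| < m)
    (hinj : ∀ x y : ZMod n, x + (t x : ZMod n) = y + (t y : ZMod n) → x = y)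
    (h1 : ∀ (x : ZMod n) (j : ℤ), |j| < m → t x < j → -j ≤ t (x + m + j))
    (h2 : ∀ (x : ZMod n) (j : ℤ), |j| < m → j < t x → t (x + m + j) ≤ -j) (x : ZMod n) :
    -1 ≤ t x ∧ t x ≤ 1 := by
  refine ⟨?_, deviation_le_one hn hm hlt hinj h1 h2 x⟩
  have hmm := half_add_half hn
  have e : ∀ (x : ZMod n) (j : ℤ), -(x + m + (j : ZMod n)) = -x + m + ((-j : ℤ) : ZMod n) := by
    intro x j; push_cast; linear_combination -hmm
  have := deviation_le_one (t := fun x => -t (-x)) hn hm (fun x => by simpa using hlt (-x)) ?_ ?_ ?_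
    (-x)
  · simp only [neg_neg] at this; omega
  · intro x y h
    push_cast at h
    exact neg_injective (hinj (-x) (-y) (by linear_combination -h))
  · intro x j hj hx
    have := h2 (-x) (-j) (by simpa using hj) (by omega)
    simp only [e]; omega
  · intro x j hj hx
    have := h1 (-x) (-j) (by simpa using hj) (by omega)
    simp only [e]; omega

end Deviation

end MaxTSP

/-! ### Locally optimal tours are ladders -/

namespace MaxTSP

section Shape

variable {n m : ℕ}

theorem add_natCast_injOn {x : ZMod n} {a b : ℕ} (ha : a < n) (hb : b < n)
    (h : x + (a : ZMod n) = x + b) : a = b := by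
  have h2 := congrArg ZMod.val (add_left_cancel h)
  rwa [ZMod.val_natCast_of_lt ha, ZMod.val_natCast_of_lt hb] at h2

theorem succ_sub_val_pos (hn : 2 ≤ n) (σ : Equiv.Perm (ZMod n)) (x : ZMod n) :
    0 < (succ σ x - x).val := by
  rw [Nat.pos_iff_ne_zero, Ne, ZMod.val_eq_zero, sub_eq_zero]
  exact succ_ne hn σ x

variable [NeZero n]

/-- The number of steps by which the edge from `x` to its successor exceeds a diagonal. -/
def deviation (m : ℕ) (σ : Equiv.Perm (ZMod n)) (x : ZMod n) : ℤ :=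
  ((succ σ x - x).val : ℤ) - m

theorem succ_eq_add_deviation (m : ℕ) (σ : Equiv.Perm (ZMod n)) (x : ZMod n) :
    succ σ x = x + m + (deviation m σ x : ZMod n) := by
  simp [deviation]

theorem succ_eq_add_val (σ : Equiv.Perm (ZMod n)) (x : ZMod n) :
    succ σ x = x + ((succ σ x - x).val : ZMod n) := by
  simp

variable {p : ZMod n → Plane} {σ : Equiv.Perm (ZMod n)}

/-- Otherwise, with y = x + m + j, the cyclic order is x, succ x, y, succ y, and exchanging the two
edges turns opposite sides into diagonals. -/
theorem IsLocallyOptimal.le_deviation (hp : IsConvexPolygon p) (hn : n = 2 * m) (hm : 2 ≤ m)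
    (h : IsLocallyOptimal p (tourEdges σ)) (x : ZMod n) (j : ℤ) (hj : |j| < m)
    (hx : deviation m σ x < j) : -j ≤ deviation m σ (x + m + j) := by
  rw [abs_lt] at hj
  obtain ⟨u, hu⟩ : ∃ u : ℕ, (u : ℤ) = m + j := ⟨(m + j).toNat, by omega⟩
  have hy : x + m + (j : ZMod n) = x + (u : ZMod n) := by
    have := congrArg (Int.cast : ℤ → ZMod n) hu
    push_cast at this
    rw [this]; ring
  rw [hy]
  by_contra! hc
  have hsx := succ_eq_add_val σ x
  have hsy := succ_eq_add_val σ (x + u)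
  have px := succ_sub_val_pos (by omega) σ x
  have py := succ_sub_val_pos (by omega) σ (x + u)
  unfold deviation at hx hc
  generalize (succ σ x - x).val = a at *
  generalize (succ σ (x + u) - (x + u)).val = b at *
  have hsy' : succ σ (x + u) = x + ((u + b : ℕ) : ZMod n) := by rw [hsy]; push_cast; ring
  have q := (hp.quadrangle x px (show a < u by omega) (show u < u + b by omega) (by omega)).1
  have l := h.dist_add_dist_le (by omega) (x := x) (y := x + u)
    (fun h0 => by
      have := add_natCast_injOn (x := x) (a := 0) (b := u) (by omega) (by omega) (by simpa using h0)
      omega)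
    (fun h0 => by
      rw [hsx] at h0
      have := add_natCast_injOn (by omega) (by omega) h0
      omega)
    (fun h0 => by
      rw [hsy'] at h0
      have := add_natCast_injOn (x := x) (a := u + b) (b := 0) (by omega) (by omega)
        (by rw [h0]; simp)
      omega)
  rw [hsx, hsy'] at l
  linarith

/-- The mirror case: a violation gives the cyclic order x, succ y, y, succ x. -/
theorem IsLocallyOptimal.deviation_le (hp : IsConvexPolygon p) (hn : n = 2 * m) (hm : 2 ≤ m)
    (h : IsLocallyOptimal p (tourEdges σ)) (x : ZMod n) (j : ℤ) (hj : |j| < m)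
    (hx : j < deviation m σ x) : deviation m σ (x + m + j) ≤ -j := by
  rw [abs_lt] at hj
  obtain ⟨u, hu⟩ : ∃ u : ℕ, (u : ℤ) = m + j := ⟨(m + j).toNat, by omega⟩
  have hy : x + m + (j : ZMod n) = x + (u : ZMod n) := by
    have := congrArg (Int.cast : ℤ → ZMod n) hu
    push_cast at this
    rw [this]; ring
  rw [hy]
  by_contra! hc
  have hsx := succ_eq_add_val σ x
  have hsy := succ_eq_add_val σ (x + u)
  have lx := ZMod.val_lt (succ σ x - x)
  have ly := ZMod.val_lt (succ σ (x + (u : ZMod n)) - (x + (u : ZMod n)))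
  unfold deviation at hx hc
  generalize (succ σ x - x).val = a at *
  generalize (succ σ (x + u) - (x + u)).val = b at *
  -- The edge from y wraps past x, so its end has position v = u + b - n relative to x.
  obtain ⟨v, hv⟩ : ∃ v : ℕ, u + b = v + n := ⟨u + b - n, by omega⟩
  have hsy' : succ σ (x + u) = x + (v : ZMod n) := by
    have := congrArg (Nat.cast : ℕ → ZMod n) hv
    push_cast at this
    rw [ZMod.natCast_self] at this
    rw [hsy]; linear_combination this
  have q := (hp.quadrangle x (show 0 < v by omega) (show v < u by omega) (show u < a by omega)
    (by omega)).2
  have l := h.dist_add_dist_le (by omega) (x := x) (y := x + u)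
    (fun h0 => by
      have := add_natCast_injOn (x := x) (a := 0) (b := u) (by omega) (by omega) (by simpa using h0)
      omega)
    (fun h0 => by
      rw [hsx] at h0
      have := add_natCast_injOn (by omega) (by omega) h0
      omega)
    (fun h0 => by
      rw [hsy'] at h0
      have := add_natCast_injOn (x := x) (a := v) (b := 0) (by omega) (by omega)
        (by rw [h0]; simp)
      omega)
  rw [hsx, hsy'] at l
  rw [dist_comm (p (x + (u : ZMod n))), dist_comm (p (x + (a : ZMod n)))] at l
  linarith

/-- In a locally optimal tour every edge joins `x` to `x + m - 1`, `x + m` or `x + m + 1`. -/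
theorem IsLocallyOptimal.abs_deviation_le_one (hp : IsConvexPolygon p) (hn : n = 2 * m)
    (hm : 2 ≤ m) (h : IsLocallyOptimal p (tourEdges σ)) (x : ZMod n) :
    -1 ≤ deviation m σ x ∧ deviation m σ x ≤ 1 := by
  refine MaxTSP.abs_deviation_le_one hn hm ?_ ?_ (h.le_deviation hp hn hm) (h.deviation_le hp hn hm) x
  · intro x
    have := ZMod.val_lt (succ σ x - x)
    have := succ_sub_val_pos (by omega) σ x
    rw [abs_lt]; unfold deviation; omega
  · intro x y hxy
    apply succ_injective σ
    rw [succ_eq_add_deviation m, succ_eq_add_deviation m]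
    linear_combination hxy

/-- The two diagonals at `i` and `i + 1` and all the near-diagonals except those that join
`i + 1` to `i + m` and `i` to `i + 1 + m`. -/
def ladderEdges (m : ℕ) (i : ZMod n) : Finset (Sym2 (ZMod n)) :=
  {s(i, i + (m : ZMod n)), s(i + 1, i + 1 + (m : ZMod n))} ∪
    ((Finset.univ.erase (i + 1)).erase (i + 1 + (m : ZMod n))).image
      fun j => s(j, j + (m : ZMod n) - 1)

theorem nearDiagonal_mem_ladderEdges {i j : ZMod n} (h1 : j ≠ i + 1)
    (h2 : j ≠ i + 1 + (m : ZMod n)) : s(j, j + (m : ZMod n) - 1) ∈ ladderEdges m i := by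
  refine Finset.mem_union_right _ (Finset.mem_image_of_mem _ ?_)
  simp [h1, h2]

theorem card_ladderIndices (hn : n = 2 * m) (hm : 2 ≤ m) (i : ZMod n) :
    ((Finset.univ.erase (i + 1)).erase (i + 1 + (m : ZMod n))).card = n - 2 := by
  have : (m : ZMod n) ≠ 0 := natCast_ne_zero_of_lt (by omega) (by omega)
  rw [Finset.card_erase_of_mem (by simp [this]), Finset.card_erase_of_mem (Finset.mem_univ _),
    Finset.card_univ, ZMod.card]
  omega

theorem card_ladderEdges_le (hn : n = 2 * m) (hm : 2 ≤ m) (i : ZMod n) :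
    (ladderEdges m i).card ≤ n := by
  refine (Finset.card_union_le _ _).trans ?_
  have h1 := Finset.card_le_two (a := s(i, i + (m : ZMod n))) (b := s(i + 1, i + 1 + (m : ZMod n)))
  have h2 := Finset.card_image_le (s := (Finset.univ.erase (i + 1)).erase (i + 1 + (m : ZMod n)))
    (f := fun j => s(j, j + (m : ZMod n) - 1))
  rw [card_ladderIndices hn hm] at h2
  omega

theorem ladderEdges_add_half (hn : n = 2 * m) (i : ZMod n) :
    ladderEdges m (i + (m : ZMod n)) = ladderEdges m i := by
  have hmm := half_add_half hn
  have e1 : i + (m : ZMod n) + m = i := by linear_combination hmm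
  have e2 : i + (m : ZMod n) + 1 + m = i + 1 := by linear_combination hmm
  have e3 : i + (m : ZMod n) + 1 = i + 1 + m := by ring
  unfold ladderEdges
  rw [e1, e2, e3, Sym2.eq_swap, Sym2.eq_swap (a := i + 1 + (m : ZMod n)), Finset.erase_right_comm]

/-- A cyclic permutation that moves every `x` to `x + m - 1`, `x + m` or `x + m + 1` only uses the
edges of one of the ladders. -/
theorem tourEdges_subset_ladderEdges (hn : n = 2 * m) (hm : 2 ≤ m)
    (hdev : ∀ x, -1 ≤ deviation m σ x ∧ deviation m σ x ≤ 1)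
    (hpos : ∀ x, 0 < deviation m σ x → deviation m σ (x + m) ≤ 0)
    (hneg : ∀ x, deviation m σ x < 0 → 0 ≤ deviation m σ (x + m)) :
    ∃ i, tourEdges σ ⊆ ladderEdges m i := by
  have hmm := half_add_half hn
  have z1 : (1 : ZMod n) ≠ 0 := by
    simpa using natCast_ne_zero_of_lt (n := n) (k := 1) (by omega) (by omega)
  have z2 : (2 : ZMod n) ≠ 0 := by
    simpa using natCast_ne_zero_of_lt (n := n) (k := 2) (by omega) (by omega)
  have hS := mem_of_succ_closed σ
  have hinj := succ_injective σ
  have hs : ∀ x, succ σ x = x + m + (deviation m σ x : ZMod n) := succ_eq_add_deviation m σ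
  generalize deviation m σ = t at hdev hpos hneg hs
  have hinj' : ∀ x y, x + (t x : ZMod n) = y + (t y : ZMod n) → x = y := by
    intro x y h
    apply hinj
    rw [hs, hs]; linear_combination h
  -- a long edge is followed by a short one
  have step : ∀ x, t x = 1 → t (x + 1) = -1 := by
    intro x hx
    have no0 : ∀ x, t x = 1 → t (x + 1) ≠ 0 := by
      intro x hx h0
      have := hinj' (x + 1) x (by rw [hx, h0]; push_cast; ring)
      exact z1 (by linear_combination this)
    by_contra hne
    have hx1 : t (x + 1) = 1 := by
      have := no0 x hx
      have := hdev (x + 1)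
      omega
    -- Two adjacent long edges block the ends of every non-long edge out of the next vertex; long
    -- edges then continue up to x + m, against `hpos`.
    have all : ∀ i : ℕ, t (x + i) = 1 ∧ t (x + i + 1) = 1 := by
      intro i
      induction i with
      | zero => simpa using ⟨hx, hx1⟩
      | succ i ih =>
        obtain ⟨ih1, ih2⟩ := ih
        have e : x + ((i + 1 : ℕ) : ZMod n) = x + i + 1 := by push_cast; ring
        rw [e]
        refine ⟨ih2, ?_⟩
        generalize x + (i : ZMod n) = y at ih1 ih2
        have a := no0 (y + 1) ih2
        have b := hdev (y + 1 + 1)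
        have c : t (y + 1 + 1) ≠ -1 := by
          intro h
          have := hinj' (y + 1 + 1) y (by rw [h, ih1]; push_cast; ring)
          exact z2 (by linear_combination this)
        omega
    have a := (all m).1
    have b := hpos x (by omega)
    omega
  have pred : ∀ x, t (x + 1) = -1 → t x = 1 := by
    intro x hx
    have no0 : ∀ x, t (x + 1) = -1 → t x ≠ 0 := by
      intro x hx h0
      have := hinj' (x + 1) x (by rw [hx, h0]; push_cast; ring)
      exact z1 (by linear_combination this)
    by_contra hne
    have hx1 : t x = -1 := by
      have := no0 x hx
      have := hdev x
      omega
    have all : ∀ i : ℕ, t (x - i) = -1 ∧ t (x - i + 1) = -1 := by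
      intro i
      induction i with
      | zero => simpa using ⟨hx1, hx⟩
      | succ i ih =>
        obtain ⟨ih1, ih2⟩ := ih
        have e : x - ((i + 1 : ℕ) : ZMod n) + 1 = x - i := by push_cast; ring
        rw [e]
        refine ⟨?_, ih1⟩
        rw [← e] at ih1 ih2
        generalize x - ((i + 1 : ℕ) : ZMod n) = y at ih1 ih2
        have a := no0 y ih1
        have b := hdev y
        have c : t y ≠ 1 := by
          intro h
          have := hinj' (y + 1 + 1) y (by rw [h, ih2]; push_cast; ring)
          exact z2 (by linear_combination this)
        omega
    have a := (all m).1
    have b := hneg x (by omega)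
    rw [show x - (m : ZMod n) = x + m by linear_combination -hmm] at a
    omega
  -- a gap without edges exists
  obtain ⟨g, hg, hg'⟩ : ∃ g, t g ≠ -1 ∧ t (g + m) ≠ -1 := by
    by_contra! hcon
    have hcon' : ∀ x, t x ≠ -1 → t (x + m) = -1 := hcon
    obtain ⟨x, hx⟩ : ∃ x, t x = 1 := by
      by_cases h0 : t 0 = -1
      · exact ⟨-1, pred _ (by simpa using h0)⟩
      · exact ⟨m - 1, pred _ (by simpa using hcon' 0 h0)⟩
    -- The vertex y + 2 cannot have a short edge, so its opposite does; the vertex before that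
    -- opposite is y + m + 1 = succ y, whose edge is therefore long.
    have hcl : ∀ y ∈ {x | t x = 1}, succ σ y ∈ {x | t x = 1} := by
      intro y hy
      have hy : t y = 1 := hy
      have h1 := step y hy
      have h2 : t (y + 1 + 1) ≠ -1 := by
        intro h; have := pred _ h; omega
      have h3 := hcon' _ h2
      have h4 := pred (y + m + 1) (by rw [← h3]; congr 1; ring)
      show t _ = 1
      rw [hs, hy]; simpa using h4
    have h5 : t (x + 1) = 1 := hS _ hx hcl (x + 1)
    have := step x hx
    omega
  -- and it is unique
  have uniq : ∀ u : ℕ, 0 < u → u < m → t (g + u) ≠ -1 → t (g + u + m) ≠ -1 → False := by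
    intro u hu hum h1 h2
    -- The block between the gaps g and g + u, together with its opposite block. No swap leaves it,
    -- so the tour would stay inside and miss g + u.
    set S : Set (ZMod n) := {x | ∃ q : ℕ, q < u ∧ (x = g + q ∨ x = g + m + q)} with hSdef
    have hcl : ∀ y ∈ S, succ σ y ∈ S := by
      rintro y ⟨q, hq, hy⟩
      rw [hs]
      obtain ht | ht | ht : t y = -1 ∨ t y = 0 ∨ t y = 1 := by have := hdev y; omega
      · rcases Nat.eq_zero_or_pos q with rfl | hq0
        · exfalso
          rcases hy with rfl | rfl
          · exact hg (by simpa using ht)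
          · exact hg' (by simpa using ht)
        · have e : (q : ZMod n) = ((q - 1 : ℕ) : ZMod n) + 1 := by
            rw [Nat.cast_sub hq0]; push_cast; ring
          refine ⟨q - 1, by omega, ?_⟩
          rw [ht]; push_cast
          rcases hy with rfl | rfl
          · right; rw [e]; ring
          · left; rw [e]; linear_combination hmm
      · refine ⟨q, hq, ?_⟩
        rw [ht]; push_cast
        rcases hy with rfl | rfl
        · right; ring
        · left; linear_combination hmm
      · have hy1 := step y ht
        rcases Nat.lt_or_ge (q + 1) u with hq1 | hq1
        · refine ⟨q + 1, hq1, ?_⟩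
          rw [ht]; push_cast
          rcases hy with rfl | rfl
          · right; ring
          · left; linear_combination hmm
        · exfalso
          obtain rfl : u = q + 1 := by omega
          rcases hy with rfl | rfl
          · apply h1; rw [← hy1]; congr 1; push_cast; ring
          · apply h2; rw [← hy1]; congr 1; push_cast; ring
    obtain ⟨q, hq, h | h⟩ := hS S (x := g) ⟨0, hu, by simp⟩ hcl (g + u)
    · have := add_natCast_injOn (by omega) (by omega) h
      omega
    · have := add_natCast_injOn (x := g) (a := u) (b := m + q) (by omega) (by omega)
        (by rw [h]; push_cast; ring)
      omega
  have uniq' : ∀ x, t x ≠ -1 → t (x + m) ≠ -1 → x = g ∨ x = g + m := by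
    intro x h1 h2
    obtain ⟨u, hu, rfl⟩ : ∃ u : ℕ, u < n ∧ x = g + u := ⟨(x - g).val, ZMod.val_lt _, by simp⟩
    rcases Nat.eq_zero_or_pos u with rfl | hu0
    · left; simp
    rcases lt_trichotomy u m with h | rfl | h
    · exact (uniq u hu0 h h1 h2).elim
    · right; rfl
    · have e : (u : ZMod n) = ((u - m : ℕ) : ZMod n) + m := by
        rw [Nat.cast_sub h.le]; ring
      refine (uniq (u - m) (by omega) (by omega) ?_ ?_).elim
      · intro h0; apply h2; rw [← h0]; congr 1; rw [e]; linear_combination hmm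
      · intro h0; apply h1; rw [← h0]; congr 1; rw [e]; ring
  refine ⟨g - 1, fun e he => ?_⟩
  obtain ⟨x, rfl⟩ := (mem_tourEdges_iff_succ σ e).1 he
  rw [hs]
  obtain ht | ht | ht : t x = -1 ∨ t x = 0 ∨ t x = 1 := by have := hdev x; omega
  · rw [ht, show x + (m : ZMod n) + ((-1 : ℤ) : ZMod n) = x + m - 1 by push_cast; ring]
    apply nearDiagonal_mem_ladderEdges
    · rintro rfl; exact hg (by simpa using ht)
    · rintro rfl; exact hg' (by simpa using ht)
  · apply Finset.mem_union_left
    rw [ht, Int.cast_zero, add_zero, Finset.mem_insert, Finset.mem_singleton]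
    have hx0 : t x ≠ -1 := by omega
    have hx1 : t (x + 1) ≠ -1 := by intro h; have := pred x h; omega
    have : x = g ∨ x = g + m ∨ x + 1 = g ∨ x + 1 = g + m := by
      -- A diagonal is next to a gap: x is in no swap, so if x + m is swapped with its predecessor,
      -- the gap is at x + 1; otherwise it is at x.
      by_cases h0 : t (x + m) = -1
      · right; right
        refine uniq' _ hx1 fun h => ?_
        have := pred (x + m) (by rw [← h]; congr 1; ring)
        omega
      · have := uniq' x hx0 h0
        tauto
    rcases this with rfl | rfl | h | h
    · right; rw [sub_add_cancel]
    · right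
      rw [sub_add_cancel, Sym2.eq_swap]
      congr 2; linear_combination hmm
    · left; rw [← h]; congr 2 <;> ring
    · left
      obtain rfl : x = g + m - 1 := by linear_combination h
      rw [Sym2.eq_swap]
      congr 2
      · linear_combination hmm
      · ring
  · have hx1 := step x ht
    -- A long edge read backwards is the near-diagonal starting at x + m + 1. Were this index
    -- omitted, x + 1 would be a gap vertex with a short edge.
    have := nearDiagonal_mem_ladderEdges (m := m) (i := g - 1) (j := x + (m : ZMod n) + 1)
      (by
        intro h
        apply hg'
        rw [← hx1]; congr 1; linear_combination -h + hmm)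
      (by
        intro h
        apply hg
        rw [← hx1]; congr 1; linear_combination -h)
    rw [ht, Sym2.eq_swap]
    convert this using 2
    · push_cast; ring
    · linear_combination -hmm

/-- The inclusion in a ladder is an equality because the tour has n edges and a ladder at most n. -/
theorem IsLocallyOptimal.exists_eq_ladderEdges (hp : IsConvexPolygon p) (hn : n = 2 * m)
    (hm : 2 ≤ m) {T : Finset (Sym2 (ZMod n))} (h : IsLocallyOptimal p T) :
    ∃ i, T = ladderEdges m i := by
  obtain ⟨σ, rfl⟩ := h.1
  obtain ⟨i, hi⟩ := tourEdges_subset_ladderEdges hn hm (h.abs_deviation_le_one hp hn hm)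
    (fun x hx => by
      simpa using h.deviation_le hp hn hm x 0 (by simp; omega) hx)
    (fun x hx => by
      simpa using h.le_deviation hp hn hm x 0 (by simp; omega) hx)
  refine ⟨i, Finset.eq_of_subset_of_card_le hi ?_⟩
  rw [card_tourEdges (by omega)]
  exact card_ladderEdges_le hn hm i

end Shape

end MaxTSP

/-! ### Traversal, length and number of the ladders -/

namespace MaxTSP

section Ladder

variable {n m : ℕ}

/-- The position of the `k`-th vertex of the ladder tour relative to the ladder's first
diagonal. -/
def ladderOffset (m k : ℕ) : ℕ :=
  if k < m then (if k % 2 = 0 then m - k else 2 * m - k)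
  else (if k % 2 = 0 then k + 1 - m else k + 1)

/-- Offsets run through 1, ..., 2m, not 0, ..., 2m - 1: the last vertex has offset 2m, which is i
again modulo n. -/
theorem ladderOffset_bounds {k : ℕ} (hk : k < 2 * m) :
    0 < ladderOffset m k ∧ ladderOffset m k ≤ 2 * m := by
  unfold ladderOffset; split_ifs <;> omega

/-- The parity of k decides whether the offset exceeds m; within each range, the outward and return
halves of the traversal have opposite parities. -/
theorem ladderOffset_inj {k l : ℕ} (hk : k < 2 * m) (hl : l < 2 * m)
    (h : ladderOffset m k = ladderOffset m l) : k = l := by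
  unfold ladderOffset at h; split_ifs at h <;> omega

/-- What the ladder with first diagonal at `i` gains over the set of all near-diagonals. -/
noncomputable def gain (m : ℕ) (p : ZMod n → Plane) (i : ZMod n) : ℝ :=
  dist (p i) (p (i + (m : ZMod n))) + dist (p (i + 1)) (p (i + (m : ZMod n) + 1)) -
    dist (p (i + 1)) (p (i + (m : ZMod n))) - dist (p i) (p (i + (m : ZMod n) + 1))

/-- This allows the search to consider only the indices below m. -/
theorem gain_add_half (hn : n = 2 * m) (p : ZMod n → Plane) (i : ZMod n) :
    gain m p (i + (m : ZMod n)) = gain m p i := by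
  have hmm := half_add_half hn
  unfold gain
  rw [show i + (m : ZMod n) + m = i by linear_combination hmm, dist_comm (p i),
    dist_comm (p (i + 1)), dist_comm (p (i + 1)) (p (i + (m : ZMod n))),
    dist_comm (p i) (p (i + (m : ZMod n) + 1))]
  ring

variable [NeZero n]

/-- The ladder tour with first diagonal at `i` as a map. -/
def ladderFun (m : ℕ) (i k : ZMod n) : ZMod n := i + (ladderOffset m k.val : ZMod n)

theorem ladderFun_injective (hn : n = 2 * m) (i : ZMod n) :
    Function.Injective (ladderFun m i) := by
  intro k l h
  have hk := ZMod.val_lt k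
  have hl := ZMod.val_lt l
  have bk := ladderOffset_bounds (m := m) (k := k.val) (by omega)
  have bl := ladderOffset_bounds (m := m) (k := l.val) (by omega)
  apply ZMod.val_injective n
  apply ladderOffset_inj (m := m) (by omega) (by omega)
  unfold ladderFun at h
  have := add_natCast_injOn (x := i + 1) (a := ladderOffset m k.val - 1)
    (b := ladderOffset m l.val - 1) (by omega) (by omega) (by
      rw [Nat.cast_sub (by omega), Nat.cast_sub (by omega)]
      push_cast; linear_combination h)
  omega

/-- The ladder tour with first diagonal at `i`. -/
noncomputable def ladderPerm (hn : n = 2 * m) (i : ZMod n) : Equiv.Perm (ZMod n) :=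
  Equiv.ofBijective _ (Finite.injective_iff_bijective.1 (ladderFun_injective hn i))

theorem ladderPerm_apply (hn : n = 2 * m) (i k : ZMod n) :
    ladderPerm hn i k = i + (ladderOffset m k.val : ZMod n) := rfl

/-- The traversal zigzags down from i + m to the diagonal at i + 1, zigzags back along the remaining
near-diagonals, and closes with the diagonal at i. -/
theorem tourEdges_ladderPerm (hn : n = 2 * m) (hm : 2 ≤ m) (i : ZMod n) :
    tourEdges (ladderPerm hn i) = ladderEdges m i := by
  have hmm := half_add_half hn
  refine Finset.eq_of_subset_of_card_le ?_
    (by rw [card_tourEdges (by omega)]; exact card_ladderEdges_le hn hm i)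
  intro e he
  obtain ⟨k, -, rfl⟩ := Finset.mem_image.1 he
  rw [ladderPerm_apply, ladderPerm_apply]
  -- Here q is the offset of the index of the near-diagonal, traversed in either direction; 1 and m
  -- + 1 are the two omitted ones, and q = 2m stands for offset 0.
  have near : ∀ c d q : ℕ, q ≤ 2 * m → q ≠ 1 → q ≠ m + 1 →
      ((c : ZMod n) = q ∧ (d : ZMod n) = q + m - 1 ∨ (d : ZMod n) = q ∧ (c : ZMod n) = q + m - 1) →
      s(i + (c : ZMod n), i + (d : ZMod n)) ∈ ladderEdges m i := by
    intro c d q hq h1 h2 h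
    have hq1 : i + (q : ZMod n) ≠ i + 1 := by
      intro h0
      rcases Nat.lt_or_ge q n with hqn | hqn
      · exact h1 (add_natCast_injOn (x := i) (b := 1) hqn (by omega) (by simpa using h0))
      · obtain rfl : q = n := by omega
        have := add_natCast_injOn (x := i) (a := 0) (b := 1) (by omega) (by omega)
          (by simpa using h0)
        omega
    have hq2 : i + (q : ZMod n) ≠ i + 1 + m := by
      intro h0
      rcases Nat.lt_or_ge q n with hqn | hqn
      · exact h2 (add_natCast_injOn (x := i) (b := m + 1) hqn (by omega)
          (by rw [h0]; push_cast; ring))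
      · obtain rfl : q = n := by omega
        have := add_natCast_injOn (x := i) (a := 0) (b := m + 1) (by omega) (by omega)
          (by
            simp only [CharP.cast_eq_zero, add_zero] at h0
            push_cast; linear_combination h0)
        omega
    have := nearDiagonal_mem_ladderEdges (m := m) hq1 hq2
    rcases h with ⟨hc, hd⟩ | ⟨hd, hc⟩
    · rw [hc, hd]; convert this using 2; ring
    · rw [hc, hd, Sym2.eq_swap]; convert this using 2; ring
  have hk := ZMod.val_lt k
  have hnm : (n : ZMod n) = 0 := ZMod.natCast_self n
  by_cases hlast : k = -1
  · subst hlast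
    rw [neg_add_cancel, val_neg_one (by omega), ZMod.val_zero]
    have e1 : ladderOffset m (n - 1) = n := by unfold ladderOffset; split_ifs <;> omega
    have e2 : ladderOffset m 0 = m := by unfold ladderOffset; split_ifs <;> omega
    rw [e1, e2, hnm, add_zero]
    exact Finset.mem_union_left _ (Finset.mem_insert_self _ _)
  rw [val_add_one_of_ne (by omega) hlast]
  have hk1 : k.val + 1 < n := by
    rw [← val_add_one_of_ne (by omega) hlast]; exact ZMod.val_lt _
  generalize k.val = k at *
  rcases Nat.lt_trichotomy (k + 1) m with h | h | h
  · rcases Nat.mod_two_eq_zero_or_one k with hp | hp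
    · have e1 : ladderOffset m k = m - k := by unfold ladderOffset; split_ifs <;> omega
      have e2 : ladderOffset m (k + 1) = 2 * m - (k + 1) := by
        unfold ladderOffset; split_ifs <;> omega
      refine near _ _ (m - k) (by omega) (by omega) (by omega) (Or.inl ?_)
      rw [e1, e2]
      refine ⟨rfl, ?_⟩
      rw [Nat.cast_sub (by omega), Nat.cast_sub (by omega)]; push_cast; ring
    · have e1 : ladderOffset m k = 2 * m - k := by unfold ladderOffset; split_ifs <;> omega
      have e2 : ladderOffset m (k + 1) = m - (k + 1) := by
        unfold ladderOffset; split_ifs <;> omega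
      refine near _ _ (2 * m - k) (by omega) (by omega) (by omega) (Or.inl ?_)
      rw [e1, e2]
      refine ⟨rfl, ?_⟩
      rw [Nat.cast_sub (by omega), Nat.cast_sub (by omega)]; push_cast
      linear_combination -hmm
  · apply Finset.mem_union_left
    rw [Finset.mem_insert, Finset.mem_singleton]
    right
    rcases Nat.mod_two_eq_zero_or_one k with hp | hp
    · have e1 : ladderOffset m k = 1 := by unfold ladderOffset; split_ifs <;> omega
      have e2 : ladderOffset m (k + 1) = m + 1 := by unfold ladderOffset; split_ifs <;> omega
      rw [e1, e2, show i + ((m + 1 : ℕ) : ZMod n) = i + 1 + m by push_cast; ring, Nat.cast_one]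
    · have e1 : ladderOffset m k = m + 1 := by unfold ladderOffset; split_ifs <;> omega
      have e2 : ladderOffset m (k + 1) = 1 := by unfold ladderOffset; split_ifs <;> omega
      rw [e1, e2, show i + ((m + 1 : ℕ) : ZMod n) = i + 1 + m by push_cast; ring, Nat.cast_one,
        Sym2.eq_swap]
  · rcases Nat.mod_two_eq_zero_or_one k with hp | hp
    · have e1 : ladderOffset m k = k + 1 - m := by unfold ladderOffset; split_ifs <;> omega
      have e2 : ladderOffset m (k + 1) = k + 2 := by unfold ladderOffset; split_ifs <;> omega
      refine near _ _ (k + 2) (by omega) (by omega) (by omega) (Or.inr ?_)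
      rw [e1, e2]
      refine ⟨rfl, ?_⟩
      rw [Nat.cast_sub (by omega)]; push_cast; linear_combination -hmm
    · have e1 : ladderOffset m k = k + 1 := by unfold ladderOffset; split_ifs <;> omega
      have e2 : ladderOffset m (k + 1) = k + 2 - m := by unfold ladderOffset; split_ifs <;> omega
      refine near _ _ (k + 2 - m) (by omega) (by omega) (by omega) (Or.inr ?_)
      rw [e1, e2]
      refine ⟨rfl, ?_⟩
      rw [Nat.cast_sub (by omega)]; push_cast; ring

/-- Being a tour, the ladder has n edges, so the bound 2 + (n - 2) on its size is attained. This
gives at once that all the listed edges are distinct, and the length can be summed over indices. -/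
theorem tourLength_ladderEdges (hn : n = 2 * m) (hm : 2 ≤ m) (p : ZMod n → Plane) (i : ZMod n) :
    tourLength p (ladderEdges m i) =
      ∑ j : ZMod n, dist (p j) (p (j + (m : ZMod n) - 1)) + gain m p i := by
  have hmm := half_add_half hn
  have hm0 : (m : ZMod n) ≠ 0 := natCast_ne_zero_of_lt (by omega) (by omega)
  have hcard : (ladderEdges m i).card = n := by
    rw [← tourEdges_ladderPerm hn hm, card_tourEdges (by omega)]
  set I : Finset (ZMod n) := (Finset.univ.erase (i + 1)).erase (i + 1 + (m : ZMod n)) with hI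
  set N : ZMod n → Sym2 (ZMod n) := fun j => s(j, j + (m : ZMod n) - 1) with hN
  have hL : ladderEdges m i =
    {s(i, i + (m : ZMod n)), s(i + 1, i + 1 + (m : ZMod n))} ∪ I.image N := rfl
  have c1 := Finset.card_le_two (a := s(i, i + (m : ZMod n))) (b := s(i + 1, i + 1 + (m : ZMod n)))
  have c2 : (I.image N).card ≤ I.card := Finset.card_image_le
  have c3 : I.card = n - 2 := card_ladderIndices hn hm i
  have c4 := Finset.card_union_add_card_inter
    ({s(i, i + (m : ZMod n)), s(i + 1, i + 1 + (m : ZMod n))} : Finset (Sym2 (ZMod n))) (I.image N)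
  rw [← hL, hcard] at c4
  have hdisj : Disjoint
      ({s(i, i + (m : ZMod n)), s(i + 1, i + 1 + (m : ZMod n))} : Finset (Sym2 (ZMod n)))
      (I.image N) := by
    rw [Finset.disjoint_iff_inter_eq_empty, ← Finset.card_eq_zero]; omega
  have hinj : Set.InjOn N I := Finset.card_image_iff.1 (by omega)
  have hne : s(i, i + (m : ZMod n)) ≠ s(i + 1, i + 1 + (m : ZMod n)) := by
    intro h
    rw [h, Finset.pair_eq_singleton, Finset.card_singleton] at c4
    omega
  have hE : ∀ a b, edgeLength p s(a, b) = dist (p a) (p b) := fun a b => rfl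
  unfold tourLength
  rw [hL, Finset.sum_union hdisj, Finset.sum_pair hne, Finset.sum_image hinj]
  simp only [hN, hE]
  have s1 := Finset.add_sum_erase Finset.univ (fun j => dist (p j) (p (j + (m : ZMod n) - 1)))
    (Finset.mem_univ (i + 1))
  have s2 := Finset.add_sum_erase (Finset.univ.erase (i + 1))
    (fun j => dist (p j) (p (j + (m : ZMod n) - 1)))
    (show i + 1 + (m : ZMod n) ∈ _ by simp [hm0])
  rw [← hI] at s2
  rw [← s1, ← s2]
  unfold gain
  rw [show i + 1 + (m : ZMod n) - 1 = i + m by ring,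
    show i + 1 + (m : ZMod n) + m - 1 = i by linear_combination hmm,
    show i + 1 + (m : ZMod n) = i + m + 1 by ring, dist_comm (p (i + (m : ZMod n) + 1)) (p i)]
  ring

/-- A ladder of maximal gain is a longest tour. -/
theorem ladderEdges_longest {p : ZMod n → Plane} (hp : IsConvexPolygon p) (hn : n = 2 * m)
    (hm : 2 ≤ m) {i : ZMod n} (h : ∀ j : ℕ, j < m → gain m p (j : ZMod n) ≤ gain m p i)
    (T : Finset (Sym2 (ZMod n))) (hT : IsTour T) :
    tourLength p T ≤ tourLength p (ladderEdges m i) := by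
  obtain ⟨T₀, hT₀, hmax⟩ := exists_longest_tour p
  refine (hmax T hT).trans ?_
  obtain ⟨j, rfl⟩ :=
    (isLocallyOptimal_of_longest (by omega) hT₀ hmax).exists_eq_ladderEdges hp hn hm
  rw [tourLength_ladderEdges hn hm, tourLength_ladderEdges hn hm]
  have hj := ZMod.val_lt j
  have : gain m p j ≤ gain m p i := by
    rcases Nat.lt_or_ge j.val m with h1 | h1
    · simpa using h j.val h1
    · have := h (j.val - m) (by omega)
      rw [← gain_add_half hn, Nat.cast_sub h1] at this
      simpa using this
  linarith

theorem IsLocallyOptimal.isTwoDiagonalShape {p : ZMod n → Plane} (hp : IsConvexPolygon p)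
    (hn : n = 2 * m) (hm : 2 ≤ m) {T : Finset (Sym2 (ZMod n))} (h : IsLocallyOptimal p T) :
    IsTwoDiagonalShape T := by
  obtain ⟨i, rfl⟩ := h.exists_eq_ladderEdges hp hn hm
  have hd : n / 2 = m := by omega
  refine ⟨i, ?_, ?_, ?_⟩
  · rw [hd]; simp [ladderEdges]
  · rw [hd]; simp [ladderEdges]
  · rw [hd]
    intro e he h1 h2
    rcases Finset.mem_union.1 he with he | he
    · simp [h1, h2] at he
    · obtain ⟨j, -, rfl⟩ := Finset.mem_image.1 he
      exact ⟨j, rfl⟩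

/-- Subtracting m from an index of at least m does not change the ladder, so the indices below m
suffice. -/
theorem ncard_isLocallyOptimal_le {p : ZMod n → Plane} (hp : IsConvexPolygon p)
    (hn : n = 2 * m) (hm : 2 ≤ m) :
    {T : Finset (Sym2 (ZMod n)) | IsLocallyOptimal p T}.ncard ≤ n / 2 := by
  have hsub : {T : Finset (Sym2 (ZMod n)) | IsLocallyOptimal p T} ⊆
      (((Finset.range m).image fun i : ℕ => ladderEdges m (i : ZMod n) :
        Finset (Finset (Sym2 (ZMod n)))) : Set (Finset (Sym2 (ZMod n)))) := by
    intro T hT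
    obtain ⟨i, rfl⟩ := IsLocallyOptimal.exists_eq_ladderEdges hp hn hm hT
    rw [Finset.mem_coe, Finset.mem_image]
    have hi := ZMod.val_lt i
    rcases Nat.lt_or_ge i.val m with h1 | h1
    · exact ⟨i.val, Finset.mem_range.2 h1, by simp⟩
    · refine ⟨i.val - m, Finset.mem_range.2 (by omega), ?_⟩
      rw [← ladderEdges_add_half hn, Nat.cast_sub h1]
      simp
  refine (Set.ncard_le_ncard hsub (Finset.finite_toSet _)).trans ?_
  rw [Set.ncard_coe_finset]
  refine Finset.card_image_le.trans ?_
  rw [Finset.card_range]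
  omega

end Ladder

end MaxTSP

/-! ### The program -/

namespace RealRAM

/-- Total correctness of a counting loop. -/
theorem exec_loop {W N B : ℕ} {b : BExp} {c : Prog} {I : ℕ → State → Prop}
    (hb : ∀ k s, k ≤ N → I k s → (b.Holds s ↔ k < N))
    (hc : ∀ k s, k < N → I k s → ∃ s' t, Exec W c s s' t ∧ t ≤ B ∧ I (k + 1) s')
    (d : ℕ) : ∀ (k : ℕ) (s : State), k + d = N → I k s →
      ∃ s' t, Exec W (.loop b c) s s' t ∧ t ≤ d * (b.cost + B) + b.cost ∧ I N s' := by
  induction d with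
  | zero =>
    intro k s hk hI
    obtain rfl : k = N := by omega
    exact ⟨s, _, .loop_false (by rw [hb k s le_rfl hI]; omega), by omega, hI⟩
  | succ d ih =>
    intro k s hk hI
    obtain ⟨s₁, t₁, h₁, ht₁, hI₁⟩ := hc k s (by omega) hI
    obtain ⟨s₂, t₂, h₂, ht₂, hI₂⟩ := ih (k + 1) s₁ (by omega) hI₁
    refine ⟨s₂, _, .loop_true ((hb k s (by omega) hI).2 (by omega)) h₁ h₂, ?_, hI₂⟩
    rw [Nat.succ_mul]
    omega

/-- The distance between the points with indices `a` and `b`. -/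
def distExp (a b : NExp) : RExp :=
  .sqrt (.add
    (.mul (.sub (.get 0 a) (.get 0 b)) (.sub (.get 0 a) (.get 0 b)))
    (.mul (.sub (.get 1 a) (.get 1 b)) (.sub (.get 1 a) (.get 1 b))))

/-- The gain of the ladder whose index is in word register `2`. -/
def gainExp : RExp :=
  let a : NExp := .reg 2
  let b : NExp := .mod (.add (.reg 2) (.const 1)) (.reg 0)
  let c : NExp := .mod (.add (.reg 2) (.reg 1)) (.reg 0)
  let d : NExp := .mod (.add (.add (.reg 2) (.reg 1)) (.const 1)) (.reg 0)
  .sub (.sub (.add (distExp a c) (distExp b d)) (distExp b c)) (distExp a d)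

/-- Compare the current ladder with the best one so far. -/
def searchBody : Prog :=
  .seq (.setR 1 gainExp)
    (.seq
      (.ite (.rlt (.reg 0) (.reg 1)) (.seq (.setR 0 (.reg 1)) (.setN 3 (.reg 2))) .skip)
      (.setN 2 (.add (.reg 2) (.const 1))))

/-- Write the vertex of the ladder tour whose position is in word register `4`, with the given
offset from the ladder's first diagonal. -/
def writeVertex (e : NExp) : Prog := .putN 0 (.reg 4) (.mod (.add (.reg 3) e) (.reg 0))

/-- Write one vertex of the ladder tour. -/
def writeBody : Prog :=
  .seq
    (.ite (.nlt (.reg 4) (.reg 1))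
      (.ite (.nlt (.mod (.reg 4) (.const 2)) (.const 1))
        (writeVertex (.sub (.reg 1) (.reg 4)))
        (writeVertex (.sub (.mul (.const 2) (.reg 1)) (.reg 4))))
      (.ite (.nlt (.mod (.reg 4) (.const 2)) (.const 1))
        (writeVertex (.sub (.add (.reg 4) (.const 1)) (.reg 1)))
        (writeVertex (.add (.reg 4) (.const 1)))))
    (.setN 4 (.add (.reg 4) (.const 1)))

/-- Find the ladder of maximal gain and write its tour. -/
def longestTour : Prog :=
  .seq (.setN 1 (.div (.reg 0) (.const 2)))
    -- Word registers 2 and 3 are still 0, so this records the gain of ladder 0, the initial best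
    -- candidate.
    (.seq (.setR 0 gainExp)
      (.seq (.loop (.nlt (.reg 2) (.reg 1)) searchBody)
        (.loop (.nlt (.reg 4) (.reg 0)) writeBody)))

end RealRAM

/-! ### Correctness and running time of the program -/

namespace MaxTSP

open RealRAM

section Algorithm

variable {n m : ℕ} [NeZero n]

theorem dist_eq_sqrt (x y : Plane) :
    dist x y = Real.sqrt ((x 0 - y 0) * (x 0 - y 0) + (x 1 - y 1) * (x 1 - y 1)) := by
  rw [EuclideanSpace.dist_eq, Fin.sum_univ_two, Real.dist_eq, Real.dist_eq, sq_abs, sq_abs]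
  ring_nf

/-- The real arrays `0` and `1` hold the coordinates of the points. -/
def HoldsPoints (p : ZMod n → Plane) (s : State) : Prop :=
  ∀ k < n, s.rarr 0 k = p (k : ZMod n) 0 ∧ s.rarr 1 k = p (k : ZMod n) 1

omit [NeZero n] in
theorem eval_distExp {p : ZMod n → Plane} {s : State} (hs : HoldsPoints p s) {a b : NExp}
    (ha : a.eval s < n) (hb : b.eval s < n) :
    (distExp a b).eval s = dist (p (a.eval s : ℕ)) (p (b.eval s : ℕ)) := by
  simp only [distExp, RExp.eval, (hs _ ha).1, (hs _ ha).2, (hs _ hb).1, (hs _ hb).2, dist_eq_sqrt]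

theorem eval_gainExp {p : ZMod n → Plane} {s : State} (hs : HoldsPoints p s)
    (h0 : s.nreg 0 = n) (h1 : s.nreg 1 = m) (h2 : s.nreg 2 < n) :
    gainExp.eval s = gain m p (s.nreg 2 : ZMod n) := by
  have hn : 0 < n := NeZero.pos n
  simp only [gainExp, RExp.eval]
  rw [eval_distExp hs, eval_distExp hs, eval_distExp hs, eval_distExp hs]
  · simp only [NExp.eval, h0, h1, ZMod.natCast_mod, Nat.cast_add, Nat.cast_one, gain]
  all_goals simp only [NExp.eval, h0]
  all_goals first | exact h2 | exact Nat.mod_lt _ hn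

/-- The invariant of the search for the best ladder. -/
structure SearchInv (m : ℕ) (p : ZMod n → Plane) (k : ℕ) (s : State) : Prop where
  points : HoldsPoints p s
  size : s.nreg 0 = n
  half : s.nreg 1 = m
  counter : s.nreg 2 = k
  best_lt : s.nreg 3 < m
  output_counter : s.nreg 4 = 0
  best_gain : s.rreg 0 = gain m p (s.nreg 3 : ZMod n)
  best_max : ∀ j < k, gain m p (j : ZMod n) ≤ gain m p (s.nreg 3 : ZMod n)

/-- The invariant of the output loop. -/
structure WriteInv (n m b k : ℕ) (s : State) : Prop where
  size : s.nreg 0 = n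
  half : s.nreg 1 = m
  best : s.nreg 3 = b
  counter : s.nreg 4 = k
  written : ∀ j < k, s.narr 0 j = (b + ladderOffset m j) % n

theorem searchBody_exec {W : ℕ} {p : ZMod n → Plane} (hn : n = 2 * m) (hW : n ≤ W) {k : ℕ}
    {s : State} (hk : k < m) (hs : SearchInv m p k s) :
    ∃ s' t, Exec W searchBody s s' t ∧ t ≤ 1000 ∧ SearchInv m p (k + 1) s' := by
  obtain ⟨hp, h0, h1, h2, h3, h4, hg, hmax⟩ := hs
  have he : gainExp.eval s = gain m p (k : ZMod n) := by
    rw [eval_gainExp hp h0 h1 (by omega), h2]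
  by_cases hlt : gain m p (s.nreg 3 : ZMod n) < gain m p (k : ZMod n)
  · refine ⟨_, _, .seq (.setR _ _ _) (.seq (.ite_true ?_ (.seq (.setR _ _ _) (.setN _ _ _ ?_)))
      (.setN _ _ _ ?_)), ?_, ?_⟩
    · simpa [BExp.Holds, RExp.eval, he, hg] using hlt
    · simp [NExp.eval, h2]; omega
    · simp [NExp.eval, h2]; omega
    -- The cost along a fixed branch does not depend on the memory, so it is a numeral.
    · decide
    · refine ⟨hp, ?_, ?_, ?_, ?_, ?_, ?_, ?_⟩
      · simpa using h0
      · simpa using h1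
      · simp [NExp.eval, h2]
      · simpa [NExp.eval, h2] using hk
      · simpa using h4
      · simp [NExp.eval, RExp.eval, h2, he]
      · intro j hj
        simp only [NExp.eval, Function.update_self, h2, ne_eq,
          Nat.reduceEqDiff, not_false_eq_true, Function.update_of_ne]
        rcases Nat.lt_succ_iff_lt_or_eq.1 hj with hj | rfl
        · exact (hmax j hj).trans hlt.le
        · exact le_rfl
  · refine ⟨_, _, .seq (.setR _ _ _) (.seq (.ite_false ?_ (.skip _)) (.setN _ _ _ ?_)), ?_, ?_⟩
    · simpa [BExp.Holds, RExp.eval, he, hg] using hlt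
    · simp [NExp.eval, h2]; omega
    · decide
    · refine ⟨hp, ?_, ?_, ?_, ?_, ?_, ?_, ?_⟩
      · simpa using h0
      · simpa using h1
      · simp [NExp.eval, h2]
      · simpa using h3
      · simpa using h4
      · simpa using hg
      · intro j hj
        simp only [ne_eq, Nat.reduceEqDiff, not_false_eq_true,
          Function.update_of_ne]
        rcases Nat.lt_succ_iff_lt_or_eq.1 hj with hj | rfl
        · exact hmax j hj
        · exact not_lt.1 hlt

omit [NeZero n] in
theorem writeVertex_exec {W b k : ℕ} {e : NExp} {s : State} (hW : n ≤ W) (hk : k < n)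
    (hs : WriteInv n m b k s) (he : e.eval s = ladderOffset m k) :
    ∃ s', Exec W (writeVertex e) s s' (e.cost + 6) ∧ WriteInv n m b k s' ∧
      s'.narr 0 k = (b + ladderOffset m k) % n := by
  obtain ⟨h0, h1, h3, h4, hw⟩ := hs
  have hmod := Nat.mod_lt (b + ladderOffset m k) (show 0 < n by omega)
  have hE := Exec.putN (W := W) 0 (.reg 4) (.mod (.add (.reg 3) e) (.reg 0)) s
    (by simp only [NExp.eval, h4]; omega) (by simp only [NExp.eval, h3, h0, he]; omega)
  have hcost : (NExp.reg 4).cost + (NExp.mod (.add (.reg 3) e) (.reg 0)).cost + 1 = e.cost + 6 := by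
    simp only [NExp.cost]; omega
  rw [hcost] at hE
  refine ⟨_, hE, ⟨h0, h1, h3, h4, ?_⟩, ?_⟩
  · intro j hj
    simp only [NExp.eval, h4, Function.update_self, Function.update_of_ne hj.ne]
    exact hw j hj
  · simp only [NExp.eval, h4, h3, h0, he, Function.update_self]

omit [NeZero n] in
theorem writeBody_exec {W b k : ℕ} {s : State} (hW : n ≤ W) (hk : k < n)
    (hs : WriteInv n m b k s) :
    ∃ s' t, Exec W writeBody s s' t ∧ t ≤ 1000 ∧ WriteInv n m b (k + 1) s' := by
  have ⟨h0, h1, h3, h4, hw⟩ := hs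
  -- The counter increment shared by all four branches; the bound 900 leaves room for its cost.
  have finish : ∀ {c : Prog} {s₁ : State} {t : ℕ}, Exec W c s s₁ t → t ≤ 900 →
      WriteInv n m b k s₁ → s₁.narr 0 k = (b + ladderOffset m k) % n →
      ∃ s' t, Exec W (.seq c (.setN 4 (.add (.reg 4) (.const 1)))) s s' t ∧ t ≤ 1000 ∧
        WriteInv n m b (k + 1) s' := by
    rintro c s₁ t hc ht ⟨g0, g1, g3, g4, gw⟩ hk1
    refine ⟨_, _, .seq hc (.setN _ _ _ ?_), ?_, ⟨?_, ?_, ?_, ?_, ?_⟩⟩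
    · simp only [NExp.eval, g4]; omega
    · simp only [NExp.cost]; omega
    · simpa using g0
    · simpa using g1
    · simpa using g3
    · simp [NExp.eval, g4]
    · intro j hj
      rcases Nat.lt_succ_iff_lt_or_eq.1 hj with hj | rfl
      · exact gw j hj
      · exact hk1
  have hpar : (BExp.nlt (.mod (.reg 4) (.const 2)) (.const 1)).Holds s ↔ k % 2 = 0 := by
    simp [BExp.Holds, NExp.eval, h4]
  have hhalf : (BExp.nlt (.reg 4) (.reg 1)).Holds s ↔ k < m := by
    simp [BExp.Holds, NExp.eval, h4, h1]
  by_cases c1 : k < m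
  · by_cases c2 : k % 2 = 0
    · obtain ⟨s₁, e₁, i₁, w₁⟩ := writeVertex_exec (e := .sub (.reg 1) (.reg 4)) hW hk hs
        (by simp only [NExp.eval, h1, h4, ladderOffset, if_pos c1, if_pos c2])
      exact finish (.ite_true (hhalf.2 c1) (.ite_true (hpar.2 c2) e₁)) (by decide) i₁ w₁
    · obtain ⟨s₁, e₁, i₁, w₁⟩ := writeVertex_exec
        (e := .sub (.mul (.const 2) (.reg 1)) (.reg 4)) hW hk hs
        (by simp only [NExp.eval, h1, h4, ladderOffset, if_pos c1, if_neg c2])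
      exact finish (.ite_true (hhalf.2 c1) (.ite_false (mt hpar.1 c2) e₁)) (by decide) i₁ w₁
  · by_cases c2 : k % 2 = 0
    · obtain ⟨s₁, e₁, i₁, w₁⟩ := writeVertex_exec
        (e := .sub (.add (.reg 4) (.const 1)) (.reg 1)) hW hk hs
        (by simp only [NExp.eval, h1, h4, ladderOffset, if_neg c1, if_pos c2])
      exact finish (.ite_false (mt hhalf.1 c1) (.ite_true (hpar.2 c2) e₁)) (by decide) i₁ w₁
    · obtain ⟨s₁, e₁, i₁, w₁⟩ := writeVertex_exec
        (e := .add (.reg 4) (.const 1)) hW hk hs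
        (by simp only [NExp.eval, h4, ladderOffset, if_neg c1, if_neg c2])
      exact finish (.ite_false (mt hhalf.1 c1) (.ite_false (mt hpar.1 c2) e₁)) (by decide) i₁ w₁

omit [NeZero n] in
theorem holdsPoints_inputState (p : ZMod n → Plane) : HoldsPoints p (inputState p) := by
  intro k hk
  simp [inputState, hk]

/-- The program runs in linear time and writes the traversal of a ladder of maximal gain. -/
theorem longestTour_exec (p : ZMod n → Plane) (hn : n = 2 * m) (hm : 2 ≤ m) :
    ∃ s t b, Exec (10000 * n) longestTour (inputState p) s t ∧ t ≤ 10000 * n ∧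
      (∀ j < m, gain m p ((j : ℕ) : ZMod n) ≤ gain m p ((b : ℕ) : ZMod n)) ∧
      ∀ k < n, s.narr 0 k = (b + ladderOffset m k) % n := by
  -- A generous constant: the loops cost at most about 1003 steps for each of m + n iterations, and
  -- n ≥ 4 absorbs the initialization.
  set W := 10000 * n with hW
  have hWn : n ≤ W := by omega
  have e₁ := Exec.setN (W := W) 1 (.div (.reg 0) (.const 2)) (inputState p)
    (by simp only [NExp.eval, inputState, if_pos]; omega)
  set s₁ : State := { inputState p with
    nreg := Function.update (inputState p).nreg 1
      ((NExp.div (.reg 0) (.const 2)).eval (inputState p)) } with hs₁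
  have hp₁ : HoldsPoints p s₁ := holdsPoints_inputState p
  have r0 : s₁.nreg 0 = n := by simp [hs₁, inputState]
  have r1 : s₁.nreg 1 = m := by simp [hs₁, inputState, NExp.eval]; omega
  have r2 : s₁.nreg 2 = 0 := by simp [hs₁, inputState]
  have r3 : s₁.nreg 3 = 0 := by simp [hs₁, inputState]
  have r4 : s₁.nreg 4 = 0 := by simp [hs₁, inputState]
  clear_value s₁
  have e₂ := Exec.setR (W := W) 0 gainExp s₁
  rw [eval_gainExp hp₁ r0 r1 (by omega)] at e₂
  obtain ⟨s₃, t₃, e₃, ht₃, i₃⟩ := exec_loop (W := W) (N := m) (B := 1000)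
    (b := .nlt (.reg 2) (.reg 1)) (c := searchBody) (I := SearchInv m p)
    (fun k s _ hs => by simp [BExp.Holds, NExp.eval, hs.counter, hs.half])
    (fun k s hk hs => searchBody_exec hn hWn hk hs) m 0 _ (by omega)
    (⟨hp₁, r0, r1, r2, by rw [r3]; omega, r4, by simp [r2, r3], by simp⟩ : SearchInv m p 0
      { s₁ with rreg := Function.update s₁.rreg 0 (gain m p (s₁.nreg 2 : ZMod n)) })
  obtain ⟨s₄, t₄, e₄, ht₄, i₄⟩ := exec_loop (W := W) (N := n) (B := 1000)
    (b := .nlt (.reg 4) (.reg 0)) (c := writeBody) (I := WriteInv n m (s₃.nreg 3))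
    (fun k s _ hs => by simp [BExp.Holds, NExp.eval, hs.counter, hs.size])
    (fun k s hk hs => writeBody_exec hWn hk hs) n 0 s₃ (by omega)
    ⟨i₃.size, i₃.half, rfl, i₃.output_counter, by simp⟩
  refine ⟨s₄, _, s₃.nreg 3, .seq e₁ (.seq e₂ (.seq e₃ e₄)), ?_, i₃.best_max, i₄.written⟩
  have c₁ : (NExp.div (.reg 0) (.const 2)).cost = 3 := rfl
  have c₂ : gainExp.cost ≤ 1000 := by decide
  have c₃ : (BExp.nlt (.reg 2) (.reg 1)).cost = 3 := rfl
  have c₄ : (BExp.nlt (.reg 4) (.reg 0)).cost = 3 := rfl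
  rw [c₃] at ht₃
  rw [c₄] at ht₄
  rw [c₁]
  omega

end Algorithm

end MaxTSP

/-! ### Assembly -/

theorem theorem4 :
    (∀ (n : ℕ) [NeZero n] (p : ZMod n → MaxTSP.Plane),
      4 ≤ n → Even n → MaxTSP.IsConvexPolygon p →
        (∀ T : Finset (Sym2 (ZMod n)),
          MaxTSP.IsLocallyOptimal p T → MaxTSP.IsTwoDiagonalShape T) ∧
        {T : Finset (Sym2 (ZMod n)) | MaxTSP.IsLocallyOptimal p T}.ncard ≤ n / 2) ∧
    (∃ (P : RealRAM.Prog) (C : ℕ),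
      ∀ (n : ℕ) [NeZero n] (p : ZMod n → MaxTSP.Plane),
        4 ≤ n → Even n → MaxTSP.IsConvexPolygon p →
          ∃ (s : RealRAM.State) (t : ℕ) (T : Finset (Sym2 (ZMod n))),
            RealRAM.Exec (C * n) P (MaxTSP.inputState p) s t ∧ t ≤ C * n ∧
            MaxTSP.OutputsTour s T ∧
            MaxTSP.IsLocallyOptimal p T ∧
            ∀ T' : Finset (Sym2 (ZMod n)), MaxTSP.IsTour T' →
              MaxTSP.tourLength p T' ≤ MaxTSP.tourLength p T) := by
  refine ⟨fun n _ p h4 he hp => ?_, RealRAM.longestTour, 10000, fun n _ p h4 he hp => ?_⟩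
  · obtain ⟨m, hn⟩ := he.two_dvd
    exact ⟨fun T hT => hT.isTwoDiagonalShape hp hn (by omega),
      MaxTSP.ncard_isLocallyOptimal_le hp hn (by omega)⟩
  · obtain ⟨m, hn⟩ := he.two_dvd
    obtain ⟨s, t, b, hs, ht, hb, hw⟩ := MaxTSP.longestTour_exec p hn (by omega)
    have hσ := MaxTSP.tourEdges_ladderPerm hn (by omega) (b : ZMod n)
    have hmax := MaxTSP.ladderEdges_longest hp hn (by omega) hb
    have htour : MaxTSP.IsTour (MaxTSP.ladderEdges m (b : ZMod n)) := ⟨_, hσ.symm⟩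
    refine ⟨s, t, MaxTSP.ladderEdges m (b : ZMod n), hs, ht,
      ⟨MaxTSP.ladderPerm hn (b : ZMod n), fun k => ?_, hσ.symm⟩,
      MaxTSP.isLocallyOptimal_of_longest (by omega) htour hmax, hmax⟩
    -- The program's reduction modulo n is the `val` of the corresponding vertex in `ZMod n`.
    rw [hw k.val (ZMod.val_lt k), MaxTSP.ladderPerm_apply, ← Nat.cast_add, ZMod.val_natCast]
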